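/- Let $m,l$ be coprime positive odd integers with $l\ge 3$, put $t=\exp\left(\frac{i\pi m}{2l}\right)$ and $\epsilon=t^2=\exp\left(\frac{i\pi m}{l}\right)$. A finite-dimensional module over the split form of quantum $sl_2$ at $\epsilon$ is a finite-dimensional complex vector space with linear operators $E,F$, an invertible operator $x$ and operators $P_i$ ($i\in\mathbb Z$) such that $x$ commutes with $E$, $F$ and all $P_i$, and $$P_iP_j=\delta_{ij}P_i,\quad \sum_{i\in\mathbb Z}P_i=1,\quad P_iE=EP_{i-2},\quad P_iF=FP_{i+2},\quad EF-FE=\sum_{j\in\mathbb Z}\frac{x^2\epsilon^j-x^{-2}\epsilon^{-j}}{\epsilon-\epsilon^{-1}}P_j .$$ Put $K=\sum_j x^2\epsilon^jP_j$. Morphisms are the linear maps that commute with all these operators. Tensor products and the unit object are formed with $$\Delta(E)=E\otimes K+1\otimes E,\quad \Delta(F)=F\otimes 1+K^{-1}\otimes F,\quad \Delta(P_k)=\sum_{i+j=k}P_i\otimes P_j,\quad \Delta(x)=x\otimes x,$$ $$\varepsilon(E)=\varepsilon(F)=0,\quad \varepsilon(P_i)=\delta_{i,0},\quad \varepsilon(x)=1,$$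 and the dual $V^*$ with the antipode $S(E)=-EK^{-1}$, $S(F)=-KF$, $S(P_i)=P_{-i}$, $S(x)=x^{-1}$. Let $e_V:V^*\otimes V\to\mathbb C$ be the evaluation, $i_V:\mathbb C\to V\otimes V^*$, $1\mapsto\sum_j e_j\otimes e^j$, the coevaluation, and let $\mu_V:V\to V^{**}$ be the isomorphism of the ribbon structure, that is, the action of $K^{1-l}$ followed by the canonical map to the double dual. For an endomorphism $f$ of the module $V\otimes V$ the two partial traces are the endomorphisms of $V$ $$(\mathrm{id}_V\otimes\mathrm{tr}_V)(f)=(\mathrm{id}_V\otimes e_{V^*})(\mathrm{id}_V\otimes\mu_V\otimes\mathrm{id}_{V^*})(f\otimes\mathrm{id}_{V^*})(\mathrm{id}_V\otimes i_V),$$ $$(\mathrm{tr}_V\otimes\mathrm{id}_V)(f)=(e_V\otimes\mathrm{id}_V)(\mathrm{id}_{V^*}\otimes f)(\mathrm{id}_{V^*}\otimes\mu_V^{-1}\otimes\mathrm{id}_V)(i_{V^*}\otimes\mathrm{id}_V).$$ The module $V$ is called ambidextrous if $(\mathrm{id}_V\otimes\mathrm{tr}_V)(f)=(\mathrm{tr}_V\otimes\mathrm{id}_V)(f)$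 for every endomorphism $f$ of the module $V\otimes V$. For $a\in\mathbb C^*$ with $a^{4l}\ne1$ and $k\in\mathbb Z$ let $V(a,k)$ be the simple module, unique up to isomorphism, that has a nonzero vector $v$ with $Ev=0$, $xv=av$, $P_jv=\delta_{j,k}v$ and $V(a,k)=\sum_{i=0}^{l-1}\mathbb C F^iv$. **Theorem.** For every $a\in\mathbb C^*$ with $a^{4l}\neq1$ and every $k\in\mathbb Z$, the module $V(a,k)$ is ambidextrous. -/

import Mathlib

open scoped TensorProduct

universe u v

namespace SplitSl2

/-- The complex number `t = exp(iπm/(2l))`. -/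
noncomputable def tpar (m l : ℕ) : ℂ := Complex.exp (Complex.I * Real.pi * m / (2 * l))

/-- The root of unity `ε = t ^ 2 = exp(iπm/l)`. -/
noncomputable def eps (m l : ℕ) : ℂ := tpar m l ^ 2

theorem eps_ne_zero (m l : ℕ) : eps m l ≠ 0 := pow_ne_zero _ (Complex.exp_ne_zero _)

theorem eps_pow (m l : ℕ) : (eps m l ^ 2) ^ l = 1 := by
  rcases Nat.eq_zero_or_pos l with h | h
  · rw [h, pow_zero]
  · have hl : (l : ℂ) ≠ 0 := Nat.cast_ne_zero.mpr h.ne'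
    rw [eps, tpar, ← pow_mul, ← pow_mul, ← Complex.exp_nat_mul, Complex.exp_eq_one_iff]
    refine ⟨m, ?_⟩
    push_cast
    field_simp

/-- `P i`, `i ∈ ℤ`, are orthogonal idempotents, almost all of them zero, with `∑ P i = 1`.
In the endomorphism algebra of a finite dimensional space the finiteness is automatic; it is
listed so that the sum over all of `ℤ` has its proper meaning. -/
structure IsWeightSystem {A : Type*} [Ring A] (P : ℤ → A) : Prop where
  mul : ∀ i j, P i * P j = if i = j then P i else 0
  finite : (Function.support P).Finite
  sum : ∑ᶠ i, P i = 1

namespace IsWeightSystem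

variable {A : Type*} [Ring A] {P : ℤ → A}

theorem finite_mul (h : IsWeightSystem P) (c : ℤ → A) :
    (Function.support fun j => c j * P j).Finite :=
  h.finite.subset fun j hj hP => hj (by simp [hP])

theorem finsum_mul_proj (h : IsWeightSystem P) (c : ℤ → A) (i : ℤ) :
    (∑ᶠ j, c j * P j) * P i = c i * P i := by
  rw [finsum_mul' _ _ (h.finite_mul c), finsum_eq_single _ i]
  · rw [mul_assoc, h.mul, if_pos rfl]
  · intro j hj
    rw [mul_assoc, h.mul, if_neg hj, mul_zero]

theorem ext (h : IsWeightSystem P) {X Y : A} (hXY : ∀ i, X * P i = Y * P i) : X = Y := by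
  rw [← mul_one X, ← mul_one Y, ← h.sum, mul_finsum' _ _ h.finite, mul_finsum' _ _ h.finite]
  exact finsum_congr hXY

end IsWeightSystem

/-- A representation in a complex algebra `A` of the split form of quantum `sl_2` at `ε`: images
of the generators `E`, `F`, `x`, `x⁻¹` and `P i` (`i ∈ ℤ`) that satisfy the defining relations. -/
structure Rep (m l : ℕ) (A : Type*) [Ring A] [Algebra ℂ A] where
  E : A
  F : A
  x : Aˣ
  P : ℤ → A
  x_comm_E : (x : A) * E = E * x
  x_comm_F : (x : A) * F = F * x
  x_comm_P : ∀ i, (x : A) * P i = P i * x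
  weights : IsWeightSystem P
  P_mul_E : ∀ i, P i * E = E * P (i - 2)
  P_mul_F : ∀ i, P i * F = F * P (i + 2)
  E_mul_F_sub : E * F - F * E = ∑ᶠ j : ℤ,
    (eps m l - (eps m l)⁻¹)⁻¹ •
      (eps m l ^ j • (x : A) ^ 2 - eps m l ^ (-j) • ((x⁻¹ : Aˣ) : A) ^ 2) * P j

namespace Rep

variable {m l : ℕ} {A : Type*} [Ring A] [Algebra ℂ A] (ρ : Rep m l A)

theorem xinv_comm_E : ((ρ.x⁻¹ : Aˣ) : A) * ρ.E = ρ.E * ((ρ.x⁻¹ : Aˣ) : A) :=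
  (Commute.units_inv_left (show Commute (ρ.x : A) ρ.E from ρ.x_comm_E)).eq

theorem xinv_comm_F : ((ρ.x⁻¹ : Aˣ) : A) * ρ.F = ρ.F * ((ρ.x⁻¹ : Aˣ) : A) :=
  (Commute.units_inv_left (show Commute (ρ.x : A) ρ.F from ρ.x_comm_F)).eq

theorem xinv_comm_P (i : ℤ) : ((ρ.x⁻¹ : Aˣ) : A) * ρ.P i = ρ.P i * ((ρ.x⁻¹ : Aˣ) : A) :=
  (Commute.units_inv_left (show Commute (ρ.x : A) (ρ.P i) from ρ.x_comm_P i)).eq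

theorem xsq_comm_P (i : ℤ) : (ρ.x : A) ^ 2 * ρ.P i = ρ.P i * (ρ.x : A) ^ 2 :=
  (Commute.pow_left (show Commute (ρ.x : A) (ρ.P i) from ρ.x_comm_P i) 2).eq

theorem xinvsq_comm_P (i : ℤ) :
    ((ρ.x⁻¹ : Aˣ) : A) ^ 2 * ρ.P i = ρ.P i * ((ρ.x⁻¹ : Aˣ) : A) ^ 2 :=
  (Commute.pow_left (show Commute ((ρ.x⁻¹ : Aˣ) : A) (ρ.P i) from ρ.xinv_comm_P i) 2).eq

theorem xsq_mul_xinvsq : (ρ.x : A) ^ 2 * ((ρ.x⁻¹ : Aˣ) : A) ^ 2 = 1 := by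
  rw [← Units.val_pow_eq_pow_val, ← Units.val_pow_eq_pow_val, ← Units.val_mul, inv_pow,
    mul_inv_cancel, Units.val_one]

theorem xinvsq_mul_xsq : ((ρ.x⁻¹ : Aˣ) : A) ^ 2 * (ρ.x : A) ^ 2 = 1 := by
  rw [← Units.val_pow_eq_pow_val, ← Units.val_pow_eq_pow_val, ← Units.val_mul, inv_pow,
    inv_mul_cancel, Units.val_one]

/-- The image `∑ⱼ x² εʲ Pⱼ` of `K`. -/
noncomputable def Kval : A := ∑ᶠ j : ℤ, (eps m l ^ j • (ρ.x : A) ^ 2) * ρ.P j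

/-- The image `∑ⱼ x⁻² ε⁻ʲ Pⱼ` of `K⁻¹`. -/
noncomputable def Kinv : A := ∑ᶠ j : ℤ, (eps m l ^ (-j) • ((ρ.x⁻¹ : Aˣ) : A) ^ 2) * ρ.P j

theorem Kval_mul_P (i : ℤ) : ρ.Kval * ρ.P i = (eps m l ^ i • (ρ.x : A) ^ 2) * ρ.P i :=
  ρ.weights.finsum_mul_proj _ i

theorem Kinv_mul_P (i : ℤ) :
    ρ.Kinv * ρ.P i = (eps m l ^ (-i) • ((ρ.x⁻¹ : Aˣ) : A) ^ 2) * ρ.P i :=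
  ρ.weights.finsum_mul_proj _ i

theorem P_comm_of_mul_P {X : A} (hX : ∀ i, X * ρ.P i = ρ.P i * (X * ρ.P i)) (i : ℤ) :
    X * ρ.P i = ρ.P i * X := by
  apply ρ.weights.ext
  intro j
  rw [mul_assoc, ρ.weights.mul, mul_assoc, hX j, ← mul_assoc (ρ.P i), ρ.weights.mul]
  split_ifs with h
  · subst h; exact hX i
  · simp

theorem Kval_comm_P (i : ℤ) : ρ.Kval * ρ.P i = ρ.P i * ρ.Kval := by
  apply ρ.P_comm_of_mul_P
  intro j
  rw [Kval_mul_P, smul_mul_assoc, mul_smul_comm, ← mul_assoc, ← xsq_comm_P, mul_assoc,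
    ρ.weights.mul, if_pos rfl]

theorem Kinv_comm_P (i : ℤ) : ρ.Kinv * ρ.P i = ρ.P i * ρ.Kinv := by
  apply ρ.P_comm_of_mul_P
  intro j
  rw [Kinv_mul_P, smul_mul_assoc, mul_smul_comm, ← mul_assoc, ← xinvsq_comm_P, mul_assoc,
    ρ.weights.mul, if_pos rfl]

theorem Kval_mul_Kinv : ρ.Kval * ρ.Kinv = 1 := by
  apply ρ.weights.ext
  intro i
  rw [mul_assoc, Kinv_mul_P, smul_mul_assoc, xinvsq_comm_P, mul_smul_comm, ← mul_assoc, Kval_mul_P,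
    smul_mul_assoc, smul_mul_assoc, smul_smul, ← zpow_add₀ (eps_ne_zero m l), xsq_comm_P, mul_assoc,
    xsq_mul_xinvsq]
  simp

theorem Kinv_mul_Kval : ρ.Kinv * ρ.Kval = 1 := by
  apply ρ.weights.ext
  intro i
  rw [mul_assoc, Kval_mul_P, smul_mul_assoc, xsq_comm_P, mul_smul_comm, ← mul_assoc, Kinv_mul_P,
    smul_mul_assoc, smul_mul_assoc, smul_smul, ← zpow_add₀ (eps_ne_zero m l), xinvsq_comm_P,
    mul_assoc, xinvsq_mul_xsq]
  simp

/-- The image `ι(K) = ∑ⱼ x² εʲ Pⱼ` of the generator `K` of quantum `sl_2`. -/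
noncomputable def K : Aˣ := ⟨ρ.Kval, ρ.Kinv, ρ.Kval_mul_Kinv, ρ.Kinv_mul_Kval⟩

theorem E_mul_P (i : ℤ) : ρ.E * ρ.P i = ρ.P (i + 2) * ρ.E := by
  rw [P_mul_E, add_sub_cancel_right]

theorem F_mul_P (i : ℤ) : ρ.F * ρ.P i = ρ.P (i - 2) * ρ.F := by
  rw [P_mul_F, sub_add_cancel]

theorem Kval_mul_E : ρ.Kval * ρ.E = eps m l ^ 2 • (ρ.E * ρ.Kval) := by
  apply ρ.weights.ext
  intro i
  have hx : ρ.E * (ρ.x : A) ^ 2 = (ρ.x : A) ^ 2 * ρ.E :=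
    (Commute.pow_left (show Commute (ρ.x : A) ρ.E from ρ.x_comm_E) 2).eq.symm
  rw [mul_assoc, E_mul_P, ← mul_assoc, Kval_mul_P, smul_mul_assoc _ (ρ.E * ρ.Kval), mul_assoc ρ.E,
    Kval_mul_P, smul_mul_assoc, smul_mul_assoc, smul_mul_assoc, mul_smul_comm, ← mul_assoc ρ.E, hx,
    mul_assoc _ ρ.E, E_mul_P, smul_smul, ← mul_assoc, zpow_add₀ (eps_ne_zero m l), mul_comm]
  norm_cast

theorem Kval_mul_F : ρ.Kval * ρ.F = (eps m l ^ 2)⁻¹ • (ρ.F * ρ.Kval) := by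
  apply ρ.weights.ext
  intro i
  have hx : ρ.F * (ρ.x : A) ^ 2 = (ρ.x : A) ^ 2 * ρ.F :=
    (Commute.pow_left (show Commute (ρ.x : A) ρ.F from ρ.x_comm_F) 2).eq.symm
  rw [mul_assoc, F_mul_P, ← mul_assoc, Kval_mul_P, smul_mul_assoc _ (ρ.F * ρ.Kval), mul_assoc ρ.F,
    Kval_mul_P, smul_mul_assoc, smul_mul_assoc, smul_mul_assoc, mul_smul_comm, ← mul_assoc ρ.F, hx,
    mul_assoc _ ρ.F, F_mul_P, smul_smul, ← mul_assoc, zpow_sub₀ (eps_ne_zero m l), div_eq_mul_inv,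
    mul_comm]
  norm_cast

theorem Kval_pow_mul_E : ρ.Kval ^ l * ρ.E = ρ.E * ρ.Kval ^ l := by
  have h : ∀ n : ℕ, ρ.Kval ^ n * ρ.E = (eps m l ^ 2) ^ n • (ρ.E * ρ.Kval ^ n) := by
    intro n
    induction n with
    | zero => simp
    | succ n ih =>
      rw [pow_succ, mul_assoc, Kval_mul_E, mul_smul_comm, ← mul_assoc, ih, smul_mul_assoc,
        smul_smul, mul_assoc, pow_succ (eps m l ^ 2), mul_comm]
  rw [h, eps_pow, one_smul]

theorem Kval_pow_mul_F : ρ.Kval ^ l * ρ.F = ρ.F * ρ.Kval ^ l := by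
  have h : ∀ n : ℕ, ρ.Kval ^ n * ρ.F = ((eps m l ^ 2) ^ n)⁻¹ • (ρ.F * ρ.Kval ^ n) := by
    intro n
    induction n with
    | zero => simp
    | succ n ih =>
      rw [pow_succ, mul_assoc, Kval_mul_F, mul_smul_comm, ← mul_assoc, ih, smul_mul_assoc,
        smul_smul, mul_assoc, pow_succ (eps m l ^ 2), mul_inv, mul_comm]
  rw [h, eps_pow, inv_one, one_smul]

theorem E_mul_Kinv : ρ.E * ρ.Kinv = eps m l ^ 2 • (ρ.Kinv * ρ.E) := by
  have h := congrArg (fun X => ρ.Kinv * X * ρ.Kinv) ρ.Kval_mul_E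
  simp only [mul_smul_comm, smul_mul_assoc] at h
  rw [← mul_assoc, Kinv_mul_Kval, one_mul, mul_assoc, mul_assoc, Kval_mul_Kinv, mul_one] at h
  exact h

theorem F_mul_Kinv : ρ.F * ρ.Kinv = (eps m l ^ 2)⁻¹ • (ρ.Kinv * ρ.F) := by
  have h := congrArg (fun X => ρ.Kinv * X * ρ.Kinv) ρ.Kval_mul_F
  simp only [mul_smul_comm, smul_mul_assoc] at h
  rw [← mul_assoc, Kinv_mul_Kval, one_mul, mul_assoc, mul_assoc, Kval_mul_Kinv, mul_one] at h
  exact h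

theorem E_mul_F_sub_eq_K :
    ρ.E * ρ.F - ρ.F * ρ.E = (eps m l - (eps m l)⁻¹)⁻¹ • (ρ.Kval - ρ.Kinv) := by
  apply ρ.weights.ext
  intro i
  rw [E_mul_F_sub, ρ.weights.finsum_mul_proj, smul_mul_assoc, smul_mul_assoc, sub_mul, sub_mul,
    Kval_mul_P, Kinv_mul_P]

theorem x_comm_Kval : (ρ.x : A) * ρ.Kval = ρ.Kval * ρ.x := by
  apply ρ.weights.ext
  intro i
  rw [mul_assoc, Kval_mul_P, mul_assoc, x_comm_P, ← mul_assoc ρ.Kval, Kval_mul_P, mul_assoc,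
    ← x_comm_P, ← mul_assoc, ← mul_assoc, smul_mul_assoc, mul_smul_comm, ← pow_succ, ← pow_succ']

theorem x_comm_Kinv : (ρ.x : A) * ρ.Kinv = ρ.Kinv * ρ.x :=
  (Commute.units_inv_right (show Commute (ρ.x : A) (ρ.K : A) from ρ.x_comm_Kval)).eq

end Rep

/-- A finite dimensional module over the split form of quantum `sl_2`. -/
structure SplitModule (m l : ℕ) where
  carrier : Type u
  [addCommGroup : AddCommGroup carrier]
  [module : Module ℂ carrier]
  [finiteDimensional : FiniteDimensional ℂ carrier]
  rep : Rep m l (Module.End ℂ carrier)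

attribute [instance] SplitModule.addCommGroup SplitModule.module SplitModule.finiteDimensional

namespace SplitModule

variable {m l : ℕ}

instance : CoeSort (SplitModule.{u} m l) (Type u) := ⟨SplitModule.carrier⟩

/-- Morphisms are the linear maps that commute with the action of all generators. -/
structure IsHom (M : SplitModule.{u} m l) (N : SplitModule.{v} m l) (f : M →ₗ[ℂ] N) : Prop where
  map_E : f ∘ₗ M.rep.E = N.rep.E ∘ₗ f
  map_F : f ∘ₗ M.rep.F = N.rep.F ∘ₗ f
  map_x : f ∘ₗ (M.rep.x : Module.End ℂ M) = (N.rep.x : Module.End ℂ N) ∘ₗ f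
  map_P : ∀ i, f ∘ₗ M.rep.P i = N.rep.P i ∘ₗ f

/-- A module is simple if it is nonzero and every subspace that is stable under all generators is
zero or everything. -/
def IsSimple (M : SplitModule.{u} m l) : Prop :=
  Nontrivial M ∧ ∀ W : Submodule ℂ M,
    (∀ w ∈ W, M.rep.E w ∈ W) → (∀ w ∈ W, M.rep.F w ∈ W) →
    (∀ w ∈ W, (M.rep.x : Module.End ℂ M) w ∈ W) →
    (∀ w ∈ W, ((M.rep.x⁻¹ : (Module.End ℂ M)ˣ) : Module.End ℂ M) w ∈ W) →
    (∀ i, ∀ w ∈ W, M.rep.P i w ∈ W) → W = ⊥ ∨ W = ⊤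

/-! ### The unit object -/

/-- The counit: `E`, `F` act by `0`, `x` by `1` and `P i` by `δ_{i,0}`. -/
noncomputable def unitRep (m l : ℕ) : Rep m l (Module.End ℂ ℂ) where
  E := 0
  F := 0
  x := 1
  P i := if i = 0 then 1 else 0
  x_comm_E := by simp
  x_comm_F := by simp
  x_comm_P i := by simp
  weights :=
    { mul := fun i j => by by_cases hi : i = 0 <;> by_cases hj : j = 0 <;> (simp [hi, hj]; try grind)
      finite := (Set.finite_singleton (0 : ℤ)).subset fun i hi => by
        by_contra h
        simp_all
      sum := by
        rw [finsum_eq_single _ 0 (fun j hj => if_neg hj), if_pos rfl] }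
  P_mul_E i := by simp
  P_mul_F i := by simp
  E_mul_F_sub := by
    rw [finsum_eq_single _ 0 (fun j hj => by simp [hj])]
    simp

/-- The unit object of the category. -/
noncomputable abbrev unit (m l : ℕ) : SplitModule.{0} m l where
  carrier := ℂ
  rep := unitRep m l

/-! ### Tensor products -/

section Tensor

variable {V W : Type*} [AddCommGroup V] [Module ℂ V] [AddCommGroup W] [Module ℂ W]

open TensorProduct

/-- The action of `Δ(P k) = ∑_{i + j = k} P i ⊗ P j`. -/
noncomputable def tensorP (P : ℤ → Module.End ℂ V) (Q : ℤ → Module.End ℂ W) (k : ℤ) :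
    Module.End ℂ (V ⊗[ℂ] W) := ∑ᶠ i : ℤ, map (P i) (Q (k - i))

variable {P : ℤ → Module.End ℂ V} {Q : ℤ → Module.End ℂ W}

theorem map_sub_left (A B : Module.End ℂ V) (C : Module.End ℂ W) :
    map (A - B) C = map A C - map B C := by
  rw [eq_sub_iff_add_eq, ← map_add_left, sub_add_cancel]

theorem map_sub_right (A : Module.End ℂ V) (B C : Module.End ℂ W) :
    map A (B - C) = map A B - map A C := by
  rw [eq_sub_iff_add_eq, ← map_add_right, sub_add_cancel]

theorem tensorP_mul_map (hP : IsWeightSystem P) (hQ : IsWeightSystem Q) (k i j : ℤ) :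
    tensorP P Q k * map (P i) (Q j) = if k = i + j then map (P i) (Q j) else 0 := by
  have hfin : (Function.support fun i => map (P i) (Q (k - i))).Finite :=
    hP.finite.subset fun n hn h0 => hn (by simp [h0])
  rw [tensorP, finsum_mul' _ _ hfin, finsum_eq_single _ i]
  · rw [← TensorProduct.map_mul, hP.mul, if_pos rfl, hQ.mul]
    by_cases h : k = i + j
    · rw [if_pos (by omega), if_pos h, h, add_sub_cancel_left]
    · rw [if_neg (by omega), if_neg h, map_zero_right]
  · intro n hn
    rw [← TensorProduct.map_mul, hP.mul, if_neg hn, map_zero_left]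

theorem tensor_ext (hP : IsWeightSystem P) (hQ : IsWeightSystem Q)
    {X Y : Module.End ℂ (V ⊗[ℂ] W)}
    (h : ∀ i j, X * map (P i) (Q j) = Y * map (P i) (Q j)) : X = Y := by
  have h1 : ∀ i, X * map (P i) 1 = Y * map (P i) 1 := by
    intro i
    have e : map (P i) (1 : Module.End ℂ W) = ∑ᶠ j, map (P i) (Q j) := by
      rw [← hQ.sum]
      exact AddMonoidHom.map_finsum (AddMonoidHom.mk' (fun B => map (P i) B) (map_add_right (P i))) hQ.finite
    have hf : (Function.support fun j => map (P i) (Q j)).Finite :=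
      hQ.finite.subset fun n hn h0 => hn (by simp [h0])
    rw [e, mul_finsum' _ _ hf, mul_finsum' _ _ hf]
    exact finsum_congr (h i)
  have e : (1 : Module.End ℂ (V ⊗[ℂ] W)) = ∑ᶠ i, map (P i) 1 := by
    rw [← TensorProduct.map_one, ← hP.sum]
    exact AddMonoidHom.map_finsum
      (AddMonoidHom.mk' (fun B => map B (1 : Module.End ℂ W)) fun A B => map_add_left A B 1) hP.finite
  have hf : (Function.support fun i => map (P i) (1 : Module.End ℂ W)).Finite :=
    hP.finite.subset fun n hn h0 => hn (by simp [h0])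
  rw [← mul_one X, ← mul_one Y, e, mul_finsum' _ _ hf, mul_finsum' _ _ hf]
  exact finsum_congr h1

theorem tensorP_finite (hP : IsWeightSystem P) (hQ : IsWeightSystem Q) :
    (Function.support (tensorP P Q)).Finite := by
  refine (Set.Finite.image2 (· + ·) hP.finite hQ.finite).subset ?_
  intro k hk
  by_contra hne
  apply hk
  rw [tensorP]
  apply finsum_eq_zero_of_forall_eq_zero
  intro i
  by_cases h1 : P i = 0
  · rw [h1, map_zero_left]
  · have h2 : Q (k - i) = 0 := by
      by_contra h2
      exact hne ⟨i, h1, k - i, h2, by simp⟩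
    rw [h2, map_zero_right]

theorem tensorP_weights (hP : IsWeightSystem P) (hQ : IsWeightSystem Q) :
    IsWeightSystem (tensorP P Q) where
  mul a b := by
    apply tensor_ext hP hQ
    intro i j
    rw [mul_assoc, tensorP_mul_map hP hQ]
    by_cases hb : b = i + j
    · by_cases ha : a = b
      · rw [if_pos hb, if_pos ha]
      · rw [if_pos hb, if_neg ha, tensorP_mul_map hP hQ, if_neg (by omega), zero_mul]
    · rw [if_neg hb, mul_zero]
      by_cases ha : a = b
      · rw [if_pos ha, tensorP_mul_map hP hQ, if_neg (by omega)]
      · rw [if_neg ha, zero_mul]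
  finite := tensorP_finite hP hQ
  sum := by
    apply tensor_ext hP hQ
    intro i j
    rw [finsum_mul' _ _ (tensorP_finite hP hQ), finsum_eq_single _ (i + j),
      tensorP_mul_map hP hQ, if_pos rfl, one_mul]
    intro k hk
    rw [tensorP_mul_map hP hQ, if_neg hk]

theorem tensorP_mul_map_shift (hP : IsWeightSystem P) (hQ : IsWeightSystem Q)
    {X : Module.End ℂ V} {Y : Module.End ℂ W} (p q : ℤ)
    (hX : ∀ i, X * P i = P (i + p) * X) (hY : ∀ j, Y * Q j = Q (j + q) * Y) (k : ℤ) :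
    tensorP P Q k * map X Y = map X Y * tensorP P Q (k - (p + q)) := by
  apply tensor_ext hP hQ
  intro i j
  rw [mul_assoc, mul_assoc, tensorP_mul_map hP hQ, ← TensorProduct.map_mul, hX, hY,
    TensorProduct.map_mul, ← mul_assoc, tensorP_mul_map hP hQ]
  by_cases h : k = i + p + (j + q)
  · rw [if_pos h, if_pos (by omega), ← TensorProduct.map_mul, ← TensorProduct.map_mul, hX, hY]
  · rw [if_neg h, if_neg (by omega), zero_mul, mul_zero]

/-- The tensor product of two representations, through the comultiplication
`Δ(E) = E ⊗ K + 1 ⊗ E`, `Δ(F) = F ⊗ 1 + K⁻¹ ⊗ F`, `Δ(x) = x ⊗ x`,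
`Δ(P k) = ∑_{i + j = k} P i ⊗ P j`. -/
noncomputable def tensorRep (ρ : Rep m l (Module.End ℂ V)) (σ : Rep m l (Module.End ℂ W)) :
    Rep m l (Module.End ℂ (V ⊗[ℂ] W)) where
  E := map ρ.E (σ.K : Module.End ℂ W) + map 1 σ.E
  F := map ρ.F 1 + map ((ρ.K⁻¹ : (Module.End ℂ V)ˣ) : Module.End ℂ V) σ.F
  x := ⟨map (ρ.x : Module.End ℂ V) (σ.x : Module.End ℂ W),
    map ((ρ.x⁻¹ : (Module.End ℂ V)ˣ) : Module.End ℂ V)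
      ((σ.x⁻¹ : (Module.End ℂ W)ˣ) : Module.End ℂ W),
    by rw [← TensorProduct.map_mul, Units.mul_inv, Units.mul_inv, TensorProduct.map_one],
    by rw [← TensorProduct.map_mul, Units.inv_mul, Units.inv_mul, TensorProduct.map_one]⟩
  P := tensorP ρ.P σ.P
  x_comm_E := by
    change map _ _ * (map ρ.E σ.Kval + map 1 σ.E) = (map ρ.E σ.Kval + map 1 σ.E) * map _ _
    simp only [mul_add, add_mul, ← TensorProduct.map_mul]
    rw [ρ.x_comm_E, σ.x_comm_E, σ.x_comm_Kval, mul_one, one_mul]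
  x_comm_F := by
    change map _ _ * (map ρ.F 1 + map ρ.Kinv σ.F) = (map ρ.F 1 + map ρ.Kinv σ.F) * map _ _
    simp only [mul_add, add_mul, ← TensorProduct.map_mul]
    rw [ρ.x_comm_F, σ.x_comm_F, ρ.x_comm_Kinv, mul_one, one_mul]
  x_comm_P k := by
    have h := tensorP_mul_map_shift (X := (ρ.x : Module.End ℂ V)) (Y := (σ.x : Module.End ℂ W))
      ρ.weights σ.weights 0 0 (fun i => by rw [add_zero, ρ.x_comm_P])
      (fun i => by rw [add_zero, σ.x_comm_P]) k
    rw [add_zero, sub_zero] at h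
    exact h.symm
  weights := tensorP_weights ρ.weights σ.weights
  P_mul_E k := by
    change _ * (map ρ.E σ.Kval + map 1 σ.E) = (map ρ.E σ.Kval + map 1 σ.E) * _
    rw [mul_add, add_mul]
    congr 1
    · exact tensorP_mul_map_shift ρ.weights σ.weights 2 0 ρ.E_mul_P
        (fun i => by rw [add_zero, σ.Kval_comm_P]) k
    · exact tensorP_mul_map_shift ρ.weights σ.weights 0 2
        (fun i => by rw [add_zero, one_mul, mul_one]) σ.E_mul_P k
  P_mul_F k := by
    change _ * (map ρ.F 1 + map ρ.Kinv σ.F) = (map ρ.F 1 + map ρ.Kinv σ.F) * _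
    rw [mul_add, add_mul]
    congr 1
    · exact tensorP_mul_map_shift ρ.weights σ.weights (-2) 0 ρ.F_mul_P
        (fun i => by rw [add_zero, one_mul, mul_one]) k
    · exact tensorP_mul_map_shift ρ.weights σ.weights 0 (-2)
        (fun i => by rw [add_zero, ρ.Kinv_comm_P]) σ.F_mul_P k
  E_mul_F_sub := by
    change (map ρ.E σ.Kval + map 1 σ.E) * (map ρ.F 1 + map ρ.Kinv σ.F) -
      (map ρ.F 1 + map ρ.Kinv σ.F) * (map ρ.E σ.Kval + map 1 σ.E) =
      ∑ᶠ k : ℤ, (eps m l - (eps m l)⁻¹)⁻¹ •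
        (eps m l ^ k • map (ρ.x : Module.End ℂ V) (σ.x : Module.End ℂ W) ^ 2 -
          eps m l ^ (-k) • map ((ρ.x⁻¹ : (Module.End ℂ V)ˣ) : Module.End ℂ V)
            ((σ.x⁻¹ : (Module.End ℂ W)ˣ) : Module.End ℂ W) ^ 2) * tensorP ρ.P σ.P k
    have hε : eps m l ^ 2 ≠ 0 := pow_ne_zero _ (eps_ne_zero m l)
    have h1 : (map ρ.E σ.Kval + map 1 σ.E) * (map ρ.F 1 + map ρ.Kinv σ.F) -
        (map ρ.F 1 + map ρ.Kinv σ.F) * (map ρ.E σ.Kval + map 1 σ.E) =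
        (eps m l - (eps m l)⁻¹)⁻¹ • (map ρ.Kval σ.Kval - map ρ.Kinv σ.Kinv) := by
      simp only [mul_add, add_mul, ← TensorProduct.map_mul, mul_one, one_mul]
      rw [ρ.E_mul_Kinv, σ.Kval_mul_F, map_smul_left, map_smul_right, smul_smul,
        mul_inv_cancel₀ hε, one_smul]
      have e1 : map (ρ.E * ρ.F) σ.Kval - map (ρ.F * ρ.E) σ.Kval =
          map (ρ.E * ρ.F - ρ.F * ρ.E) σ.Kval :=
        (map_sub_left _ _ _).symm
      have e2 : map ρ.Kinv (σ.E * σ.F) - map ρ.Kinv (σ.F * σ.E) =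
          map ρ.Kinv (σ.E * σ.F - σ.F * σ.E) :=
        (map_sub_right _ _ _).symm
      rw [ρ.E_mul_F_sub_eq_K, map_smul_left, map_sub_left, smul_sub] at e1
      rw [σ.E_mul_F_sub_eq_K, map_smul_right, map_sub_right, smul_sub] at e2
      rw [smul_sub, ← sub_add_sub_cancel ((eps m l - (eps m l)⁻¹)⁻¹ • map ρ.Kval σ.Kval)
        ((eps m l - (eps m l)⁻¹)⁻¹ • map ρ.Kinv σ.Kval), ← e1, ← e2]
      abel
    rw [h1]
    apply tensor_ext ρ.weights σ.weights
    intro i j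
    have e : map (ρ.P i) (σ.P j) = tensorP ρ.P σ.P (i + j) * map (ρ.P i) (σ.P j) := by
      rw [tensorP_mul_map ρ.weights σ.weights, if_pos rfl]
    conv_rhs => rw [e, ← mul_assoc, (tensorP_weights ρ.weights σ.weights).finsum_mul_proj,
      mul_assoc, ← e]
    rw [smul_mul_assoc, smul_mul_assoc, sub_mul, sub_mul, ← TensorProduct.map_mul,
      ← TensorProduct.map_mul, ρ.Kval_mul_P, σ.Kval_mul_P, ρ.Kinv_mul_P, σ.Kinv_mul_P, pow_two,
      pow_two]
    simp only [smul_mul_assoc, ← TensorProduct.map_mul, map_smul_left, map_smul_right, smul_smul,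
      ← zpow_add₀ (eps_ne_zero m l), pow_two, neg_add]
    rw [add_comm j i, add_comm (-j) (-i)]

/-- The tensor product of two modules. -/
noncomputable abbrev tensor (M : SplitModule.{u} m l) (N : SplitModule.{v} m l) :
    SplitModule.{max u v} m l where
  carrier := M ⊗[ℂ] N
  rep := tensorRep M.rep N.rep

end Tensor

/-! ### Dual modules -/

section Dual

variable {V : Type*} [AddCommGroup V] [Module ℂ V]

theorem dualMap_mul (X Y : Module.End ℂ V) :
    LinearMap.dualMap (X * Y) = LinearMap.dualMap Y * LinearMap.dualMap X := rfl

theorem dualMap_smul (c : ℂ) (X : Module.End ℂ V) :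
    LinearMap.dualMap (c • X) = c • LinearMap.dualMap X :=
  map_smul (Module.Dual.transpose (R := ℂ) (M := V) (M' := V)) c X

theorem dualMap_sub (X Y : Module.End ℂ V) :
    LinearMap.dualMap (X - Y) = LinearMap.dualMap X - LinearMap.dualMap Y :=
  map_sub (Module.Dual.transpose (R := ℂ) (M := V) (M' := V)) X Y

theorem dualMap_neg (X : Module.End ℂ V) :
    LinearMap.dualMap (-X) = -LinearMap.dualMap X :=
  map_neg (Module.Dual.transpose (R := ℂ) (M := V) (M' := V)) X

theorem dualMap_zero : LinearMap.dualMap (0 : Module.End ℂ V) = 0 :=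
  map_zero (Module.Dual.transpose (R := ℂ) (M := V) (M' := V))

theorem dual_weights {P : ℤ → Module.End ℂ V} (hP : IsWeightSystem P) :
    IsWeightSystem fun i => LinearMap.dualMap (P (-i)) where
  mul i j := by
    rw [← dualMap_mul, hP.mul]
    by_cases h : i = j
    · rw [if_pos (by rw [h]), if_pos h, h]
    · rw [if_neg (by omega), if_neg h, dualMap_zero]
  finite := by
    refine (hP.finite.preimage (neg_injective.injOn)).subset fun i hi h0 => hi ?_
    have h0' : P (-i) = 0 := h0
    simp only [h0', dualMap_zero]
  sum := by
    have h1 : ∑ᶠ i, P (-i) = 1 := by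
      rw [← hP.sum]
      exact finsum_comp_equiv (Equiv.neg ℤ)
    have hf : (Function.support fun i => P (-i)).Finite :=
      hP.finite.preimage (neg_injective.injOn)
    have h2 := AddMonoidHom.map_finsum
      (Module.Dual.transpose (R := ℂ) (M := V) (M' := V)).toAddMonoidHom hf
    rw [h1] at h2
    exact h2.symm

/-- The dual representation `π* ∘ S`, through the antipode `S(E) = -E K⁻¹`, `S(F) = -K F`,
`S(x) = x⁻¹`, `S(P i) = P (-i)`. -/
noncomputable def dualRep (ρ : Rep m l (Module.End ℂ V)) :
    Rep m l (Module.End ℂ (Module.Dual ℂ V)) where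
  E := LinearMap.dualMap (-(ρ.E * ((ρ.K⁻¹ : (Module.End ℂ V)ˣ) : Module.End ℂ V)))
  F := LinearMap.dualMap (-((ρ.K : Module.End ℂ V) * ρ.F))
  x := ⟨LinearMap.dualMap ((ρ.x⁻¹ : (Module.End ℂ V)ˣ) : Module.End ℂ V),
    LinearMap.dualMap (ρ.x : Module.End ℂ V),
    by rw [← dualMap_mul, Units.mul_inv]; rfl,
    by rw [← dualMap_mul, Units.inv_mul]; rfl⟩
  P i := LinearMap.dualMap (ρ.P (-i))
  x_comm_E := by
    change LinearMap.dualMap _ * LinearMap.dualMap (-(ρ.E * ρ.Kinv)) =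
      LinearMap.dualMap (-(ρ.E * ρ.Kinv)) * LinearMap.dualMap _
    have h : ((ρ.x⁻¹ : (Module.End ℂ V)ˣ) : Module.End ℂ V) * ρ.Kinv =
        ρ.Kinv * ((ρ.x⁻¹ : (Module.End ℂ V)ˣ) : Module.End ℂ V) :=
      (Commute.units_inv_left
        (show Commute (ρ.x : Module.End ℂ V) ρ.Kinv from ρ.x_comm_Kinv)).eq
    rw [← dualMap_mul, ← dualMap_mul, neg_mul, mul_neg, mul_assoc, ← h, ← mul_assoc, ← mul_assoc,
      ρ.xinv_comm_E]
  x_comm_F := by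
    change LinearMap.dualMap _ * LinearMap.dualMap (-(ρ.Kval * ρ.F)) =
      LinearMap.dualMap (-(ρ.Kval * ρ.F)) * LinearMap.dualMap _
    have h : ((ρ.x⁻¹ : (Module.End ℂ V)ˣ) : Module.End ℂ V) * ρ.Kval =
        ρ.Kval * ((ρ.x⁻¹ : (Module.End ℂ V)ˣ) : Module.End ℂ V) :=
      (Commute.units_inv_left
        (show Commute (ρ.x : Module.End ℂ V) ρ.Kval from ρ.x_comm_Kval)).eq
    rw [← dualMap_mul, ← dualMap_mul, neg_mul, mul_neg, mul_assoc, ← ρ.xinv_comm_F, ← mul_assoc,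
      ← h, mul_assoc]
  x_comm_P i := by
    change LinearMap.dualMap _ * LinearMap.dualMap _ = LinearMap.dualMap _ * LinearMap.dualMap _
    rw [← dualMap_mul, ← dualMap_mul, ρ.xinv_comm_P]
  weights := dual_weights ρ.weights
  P_mul_E i := by
    change LinearMap.dualMap _ * LinearMap.dualMap (-(ρ.E * ρ.Kinv)) =
      LinearMap.dualMap (-(ρ.E * ρ.Kinv)) * LinearMap.dualMap _
    rw [← dualMap_mul, ← dualMap_mul, neg_mul, mul_neg, mul_assoc, ρ.Kinv_comm_P, ← mul_assoc,
      ← mul_assoc, ρ.E_mul_P, show -i + 2 = -(i - 2) by ring]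
  P_mul_F i := by
    change LinearMap.dualMap _ * LinearMap.dualMap (-(ρ.Kval * ρ.F)) =
      LinearMap.dualMap (-(ρ.Kval * ρ.F)) * LinearMap.dualMap _
    rw [← dualMap_mul, ← dualMap_mul, neg_mul, mul_neg, mul_assoc, ρ.F_mul_P, ← mul_assoc,
      ← mul_assoc, ρ.Kval_comm_P, show -i - 2 = -(i + 2) by ring]
  E_mul_F_sub := by
    change LinearMap.dualMap (-(ρ.E * ρ.Kinv)) * LinearMap.dualMap (-(ρ.Kval * ρ.F)) -
      LinearMap.dualMap (-(ρ.Kval * ρ.F)) * LinearMap.dualMap (-(ρ.E * ρ.Kinv)) =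
      ∑ᶠ j : ℤ, (eps m l - (eps m l)⁻¹)⁻¹ •
        (eps m l ^ j • LinearMap.dualMap ((ρ.x⁻¹ : (Module.End ℂ V)ˣ) : Module.End ℂ V) ^ 2 -
          eps m l ^ (-j) • LinearMap.dualMap (ρ.x : Module.End ℂ V) ^ 2) *
        LinearMap.dualMap (ρ.P (-j))
    have hε : eps m l ^ 2 ≠ 0 := pow_ne_zero _ (eps_ne_zero m l)
    have h1 : ρ.Kval * ρ.F * (ρ.E * ρ.Kinv) = ρ.F * ρ.E := by
      rw [ρ.Kval_mul_F, ρ.E_mul_Kinv, mul_smul_comm, smul_mul_assoc, smul_smul,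
        mul_inv_cancel₀ hε, one_smul, mul_assoc, ← mul_assoc ρ.Kval, ρ.Kval_mul_Kinv, one_mul]
    have h2 : ρ.E * ρ.Kinv * (ρ.Kval * ρ.F) = ρ.E * ρ.F := by
      rw [mul_assoc, ← mul_assoc ρ.Kinv, ρ.Kinv_mul_Kval, one_mul]
    rw [← dualMap_mul, ← dualMap_mul, neg_mul_neg, neg_mul_neg, h1, h2, ← dualMap_sub,
      ← neg_sub, ρ.E_mul_F_sub_eq_K, ← smul_neg, neg_sub, dualMap_smul, dualMap_sub]
    apply (dual_weights ρ.weights).ext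
    intro j
    rw [(dual_weights ρ.weights).finsum_mul_proj, smul_mul_assoc, smul_mul_assoc, sub_mul, sub_mul,
      ← dualMap_mul, ← dualMap_mul, ← ρ.Kinv_comm_P, ← ρ.Kval_comm_P, ρ.Kinv_mul_P, ρ.Kval_mul_P,
      smul_mul_assoc, smul_mul_assoc, ρ.xsq_comm_P, ρ.xinvsq_comm_P, dualMap_smul, dualMap_smul,
      smul_mul_assoc, smul_mul_assoc, neg_neg]
    rfl

theorem dualRep_Kval (ρ : Rep m l (Module.End ℂ V)) :
    (dualRep ρ).Kval = LinearMap.dualMap ρ.Kinv := by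
  apply (dual_weights ρ.weights).ext
  intro j
  refine ((dualRep ρ).Kval_mul_P j).trans ?_
  rw [← dualMap_mul, ← ρ.Kinv_comm_P, ρ.Kinv_mul_P, smul_mul_assoc, smul_mul_assoc, ρ.xinvsq_comm_P,
    dualMap_smul, neg_neg]
  rfl

theorem dualRep_Kinv (ρ : Rep m l (Module.End ℂ V)) :
    (dualRep ρ).Kinv = LinearMap.dualMap ρ.Kval := by
  apply (dual_weights ρ.weights).ext
  intro j
  refine ((dualRep ρ).Kinv_mul_P j).trans ?_
  rw [← dualMap_mul, ← ρ.Kval_comm_P, ρ.Kval_mul_P, smul_mul_assoc, smul_mul_assoc, ρ.xsq_comm_P,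
    dualMap_smul]
  rfl

/-- The dual module. -/
noncomputable abbrev dual (M : SplitModule.{u} m l) : SplitModule.{u} m l where
  carrier := Module.Dual ℂ M
  rep := dualRep M.rep

end Dual

/-! ### Duality morphisms and partial traces -/

section Trace

variable (M : SplitModule.{u} m l)

/-- The evaluation `V* ⊗ V → ℂ`, `f ⊗ w ↦ f w`. -/
noncomputable def ev : M.dual.tensor M →ₗ[ℂ] unit m l := contractLeft ℂ M

/-- The coevaluation `ℂ → V ⊗ V*`, `1 ↦ ∑ eᵢ ⊗ eⁱ`. -/
noncomputable def coev : unit m l →ₗ[ℂ] M.tensor M.dual := coevaluation ℂ M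

/-- The isomorphism `μ : V → V**` of the ribbon structure: the action of `ι(K) ^ (1 - l)` followed
by the canonical map of the vector space `V` to its double dual. -/
noncomputable def mu : M ≃ₗ[ℂ] M.dual.dual :=
  (LinearMap.GeneralLinearGroup.generalLinearEquiv ℂ M (M.rep.K ^ (1 - (l : ℤ)))).trans
    (Module.evalEquiv ℂ M)

theorem ev_comp_map (X Y : Module.End ℂ M) :
    M.ev ∘ₗ TensorProduct.map (LinearMap.dualMap X) Y = M.ev ∘ₗ TensorProduct.map 1 (X * Y) :=
  TensorProduct.ext' fun _ _ => rfl

theorem isHom_ev : IsHom (M.dual.tensor M) (unit m l) M.ev where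
  map_E := by
    change M.ev ∘ₗ (TensorProduct.map (LinearMap.dualMap (-(M.rep.E * M.rep.Kinv))) M.rep.Kval +
      TensorProduct.map 1 M.rep.E) = 0 ∘ₗ M.ev
    rw [LinearMap.comp_add, ev_comp_map, neg_mul, mul_assoc, M.rep.Kinv_mul_Kval, mul_one,
      ← LinearMap.comp_add, ← TensorProduct.map_add_right, neg_add_cancel,
      TensorProduct.map_zero_right, LinearMap.comp_zero, LinearMap.zero_comp]
  map_F := by
    change M.ev ∘ₗ (TensorProduct.map (LinearMap.dualMap (-(M.rep.Kval * M.rep.F))) 1 +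
      TensorProduct.map M.dual.rep.Kinv M.rep.F) = 0 ∘ₗ M.ev
    rw [show M.dual.rep.Kinv = LinearMap.dualMap M.rep.Kval from dualRep_Kinv M.rep,
      LinearMap.comp_add, ev_comp_map, ev_comp_map, mul_one,
      ← LinearMap.comp_add, ← TensorProduct.map_add_right, neg_add_cancel,
      TensorProduct.map_zero_right, LinearMap.comp_zero, LinearMap.zero_comp]
  map_x := by
    change M.ev ∘ₗ TensorProduct.map (LinearMap.dualMap
      ((M.rep.x⁻¹ : (Module.End ℂ M)ˣ) : Module.End ℂ M)) (M.rep.x : Module.End ℂ M) =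
      1 ∘ₗ M.ev
    rw [ev_comp_map, Units.inv_mul, TensorProduct.map_one]
    rfl
  map_P k := by
    change M.ev ∘ₗ tensorP (fun i => LinearMap.dualMap (M.rep.P (-i))) M.rep.P k =
      (if k = 0 then 1 else 0) ∘ₗ M.ev
    have hP := M.rep.weights
    have hD := dual_weights hP
    have hfin : (Function.support fun i => TensorProduct.map
        (LinearMap.dualMap (M.rep.P (-i))) (M.rep.P (k - i))).Finite :=
      hD.finite.subset fun n hn h0 => hn (by simp only [h0, TensorProduct.map_zero_left])
    have h1 : M.ev ∘ₗ tensorP (fun i => LinearMap.dualMap (M.rep.P (-i))) M.rep.P k =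
        ∑ᶠ i, M.ev ∘ₗ TensorProduct.map 1 (M.rep.P (-i) * M.rep.P (k - i)) := by
      have h2 := AddMonoidHom.map_finsum
        (AddMonoidHom.mk' (fun X : Module.End ℂ (M.dual.tensor M) => M.ev ∘ₗ X)
          (fun X Y => LinearMap.comp_add X Y M.ev)) hfin
      refine h2.trans (finsum_congr fun i => ?_)
      exact ev_comp_map M _ _
    rw [h1]
    by_cases hk : k = 0
    · have hf : (Function.support fun i => M.rep.P (-i)).Finite :=
        hP.finite.preimage (neg_injective.injOn)
      have h3 : ∑ᶠ i, M.rep.P (-i) = 1 := by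
        rw [← hP.sum]
        exact finsum_comp_equiv (Equiv.neg ℤ)
      have h2 := AddMonoidHom.map_finsum
        (AddMonoidHom.mk' (fun X : Module.End ℂ M => M.ev ∘ₗ
          TensorProduct.map (1 : Module.End ℂ M.dual) X)
          (fun X Y => by rw [TensorProduct.map_add_right, LinearMap.comp_add])) hf
      rw [h3] at h2
      rw [if_pos hk, hk]
      simp only [zero_sub, hP.mul, if_true]
      refine h2.symm.trans ?_
      change M.ev ∘ₗ TensorProduct.map 1 1 = _
      rw [TensorProduct.map_one]
      rfl
    · rw [if_neg hk]
      simp only [hP.mul]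
      rw [finsum_eq_zero_of_forall_eq_zero, LinearMap.zero_comp]
      intro i
      rw [if_neg (by omega), TensorProduct.map_zero_right, LinearMap.comp_zero]

theorem map_comp_coev (X Y : Module.End ℂ M) :
    TensorProduct.map X (LinearMap.dualMap Y) ∘ₗ M.coev =
      TensorProduct.map (X * Y) 1 ∘ₗ M.coev := by
  let Θ : M ⊗[ℂ] Module.Dual ℂ M ≃ₗ[ℂ] (M →ₗ[ℂ] M) :=
    (TensorProduct.comm ℂ M (Module.Dual ℂ M)).trans (dualTensorHomEquiv ℂ M M)
  have hΘ : ∀ (v : M) (f : Module.Dual ℂ M) (w : M), Θ (v ⊗ₜ f) w = f w • v := fun v f w => by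
    simp [Θ, dualTensorHom_apply]
  have h1 : Θ (M.coev 1) = LinearMap.id := by
    have e : M.coev 1 = ∑ i, Module.Basis.ofVectorSpace ℂ M i ⊗ₜ[ℂ]
        (Module.Basis.ofVectorSpace ℂ M).coord i := coevaluation_apply_one ℂ M
    rw [e, map_sum]
    ext w
    rw [LinearMap.sum_apply]
    simp only [hΘ, Module.Basis.coord_apply]
    exact (Module.Basis.ofVectorSpace ℂ M).sum_repr w
  have h2 : ∀ (X Y : Module.End ℂ M) (T : M ⊗[ℂ] Module.Dual ℂ M),
      Θ (TensorProduct.map X (LinearMap.dualMap Y) T) = X ∘ₗ Θ T ∘ₗ Y := by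
    intro X Y T
    induction T with
    | zero => simp
    | add a b ha hb =>
      rw [map_add, map_add, map_add, ha, hb, LinearMap.add_comp, LinearMap.comp_add]
    | tmul v f =>
      ext w
      rw [TensorProduct.map_tmul, hΘ]
      simp [hΘ]
  apply LinearMap.ext_ring
  apply Θ.injective
  change Θ (TensorProduct.map X (LinearMap.dualMap Y) (M.coev 1)) =
    Θ (TensorProduct.map (X * Y) (LinearMap.dualMap 1) (M.coev 1))
  rw [h2, h2, h1]
  rfl

theorem isHom_coev : IsHom (unit m l) (M.tensor M.dual) M.coev where
  map_E := by
    change M.coev ∘ₗ 0 = (TensorProduct.map M.rep.E M.dual.rep.Kval +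
      TensorProduct.map 1 (LinearMap.dualMap (-(M.rep.E * M.rep.Kinv)))) ∘ₗ M.coev
    rw [show M.dual.rep.Kval = LinearMap.dualMap M.rep.Kinv from dualRep_Kval M.rep,
      LinearMap.add_comp, map_comp_coev, map_comp_coev, one_mul, ← LinearMap.add_comp,
      ← TensorProduct.map_add_left, add_neg_cancel, TensorProduct.map_zero_left,
      LinearMap.comp_zero, LinearMap.zero_comp]
  map_F := by
    change M.coev ∘ₗ 0 = (TensorProduct.map M.rep.F 1 +
      TensorProduct.map M.rep.Kinv (LinearMap.dualMap (-(M.rep.Kval * M.rep.F)))) ∘ₗ M.coev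
    rw [LinearMap.add_comp, map_comp_coev, mul_neg, ← mul_assoc, M.rep.Kinv_mul_Kval, one_mul,
      ← LinearMap.add_comp, ← TensorProduct.map_add_left, add_neg_cancel,
      TensorProduct.map_zero_left, LinearMap.comp_zero, LinearMap.zero_comp]
  map_x := by
    change M.coev ∘ₗ 1 = TensorProduct.map (M.rep.x : Module.End ℂ M) (LinearMap.dualMap
      ((M.rep.x⁻¹ : (Module.End ℂ M)ˣ) : Module.End ℂ M)) ∘ₗ M.coev
    rw [map_comp_coev, Units.mul_inv, TensorProduct.map_one]
    rfl
  map_P k := by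
    change M.coev ∘ₗ (if k = 0 then 1 else 0) =
      tensorP M.rep.P (fun i => LinearMap.dualMap (M.rep.P (-i))) k ∘ₗ M.coev
    have hP := M.rep.weights
    have hfin : (Function.support fun i => TensorProduct.map (M.rep.P i)
        (LinearMap.dualMap (M.rep.P (-(k - i))))).Finite :=
      hP.finite.subset fun n hn h0 => hn (by simp only [h0, TensorProduct.map_zero_left])
    have h1 : tensorP M.rep.P (fun i => LinearMap.dualMap (M.rep.P (-i))) k ∘ₗ M.coev =
        ∑ᶠ i, TensorProduct.map (M.rep.P i * M.rep.P (-(k - i))) 1 ∘ₗ M.coev := by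
      have h2 := AddMonoidHom.map_finsum
        (AddMonoidHom.mk' (fun X : Module.End ℂ (M.tensor M.dual) => X ∘ₗ M.coev)
          (fun X Y => LinearMap.add_comp M.coev Y X)) hfin
      refine h2.trans (finsum_congr fun i => ?_)
      exact map_comp_coev M _ _
    rw [h1]
    by_cases hk : k = 0
    · have h2 := AddMonoidHom.map_finsum
        (AddMonoidHom.mk' (fun X : Module.End ℂ M =>
          TensorProduct.map X (1 : Module.End ℂ M.dual) ∘ₗ M.coev)
          (fun X Y => by rw [TensorProduct.map_add_left, LinearMap.add_comp])) hP.finite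
      rw [hP.sum] at h2
      rw [if_pos hk, hk]
      simp only [zero_sub, neg_neg, hP.mul, if_true]
      refine Eq.trans ?_ h2
      change _ = TensorProduct.map 1 1 ∘ₗ M.coev
      rw [TensorProduct.map_one]
      rfl
    · rw [if_neg hk]
      simp only [hP.mul]
      rw [finsum_eq_zero_of_forall_eq_zero, LinearMap.comp_zero]
      intro i
      rw [if_neg (by omega), TensorProduct.map_zero_left, LinearMap.zero_comp]

theorem isHom_mu : IsHom M M.dual.dual M.mu where
  map_E := by
    have h : ((M.rep.K ^ (1 - (l : ℤ)) : (Module.End ℂ M)ˣ) : Module.End ℂ M) * M.rep.E =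
        M.rep.Kval * M.rep.E * M.rep.Kinv *
          ((M.rep.K ^ (1 - (l : ℤ)) : (Module.End ℂ M)ˣ) : Module.End ℂ M) := by
      have e : (M.rep.K ^ (1 - (l : ℤ)) : (Module.End ℂ M)ˣ) = M.rep.K * (M.rep.K ^ l)⁻¹ := by
        rw [zpow_sub, zpow_one, zpow_natCast]
      have hc : (((M.rep.K ^ l)⁻¹ : (Module.End ℂ M)ˣ) : Module.End ℂ M) * M.rep.E =
          M.rep.E * (((M.rep.K ^ l)⁻¹ : (Module.End ℂ M)ˣ) : Module.End ℂ M) :=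
        (Commute.units_inv_left (show Commute ((M.rep.K ^ l : (Module.End ℂ M)ˣ) :
          Module.End ℂ M) M.rep.E from M.rep.Kval_pow_mul_E)).eq
      rw [e, Units.val_mul, mul_assoc, hc, ← mul_assoc, mul_assoc _ M.rep.Kinv,
        ← mul_assoc M.rep.Kinv]
      change _ = M.rep.Kval * M.rep.E * (M.rep.Kinv * M.rep.Kval * _)
      rw [M.rep.Kinv_mul_Kval, one_mul]
      rfl
    have h2 : M.dual.dual.rep.E =
        LinearMap.dualMap (LinearMap.dualMap (M.rep.Kval * M.rep.E * M.rep.Kinv)) := by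
      change LinearMap.dualMap (-(LinearMap.dualMap (-(M.rep.E * M.rep.Kinv)) *
        M.dual.rep.Kinv)) = _
      rw [show M.dual.rep.Kinv = LinearMap.dualMap M.rep.Kval from dualRep_Kinv M.rep,
        ← dualMap_mul, ← dualMap_neg, mul_neg, neg_neg, mul_assoc]
    rw [h2]
    refine LinearMap.ext fun v => ?_
    exact congrArg (Module.Dual.eval ℂ M) (LinearMap.congr_fun h v)
  map_F := by
    have h : ((M.rep.K ^ (1 - (l : ℤ)) : (Module.End ℂ M)ˣ) : Module.End ℂ M) * M.rep.F =
        M.rep.Kval * M.rep.F * M.rep.Kinv *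
          ((M.rep.K ^ (1 - (l : ℤ)) : (Module.End ℂ M)ˣ) : Module.End ℂ M) := by
      have e : (M.rep.K ^ (1 - (l : ℤ)) : (Module.End ℂ M)ˣ) = M.rep.K * (M.rep.K ^ l)⁻¹ := by
        rw [zpow_sub, zpow_one, zpow_natCast]
      have hc : (((M.rep.K ^ l)⁻¹ : (Module.End ℂ M)ˣ) : Module.End ℂ M) * M.rep.F =
          M.rep.F * (((M.rep.K ^ l)⁻¹ : (Module.End ℂ M)ˣ) : Module.End ℂ M) :=
        (Commute.units_inv_left (show Commute ((M.rep.K ^ l : (Module.End ℂ M)ˣ) :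
          Module.End ℂ M) M.rep.F from M.rep.Kval_pow_mul_F)).eq
      rw [e, Units.val_mul, mul_assoc, hc, ← mul_assoc, mul_assoc _ M.rep.Kinv,
        ← mul_assoc M.rep.Kinv]
      change _ = M.rep.Kval * M.rep.F * (M.rep.Kinv * M.rep.Kval * _)
      rw [M.rep.Kinv_mul_Kval, one_mul]
      rfl
    have h2 : M.dual.dual.rep.F =
        LinearMap.dualMap (LinearMap.dualMap (M.rep.Kval * M.rep.F * M.rep.Kinv)) := by
      change LinearMap.dualMap (-(M.dual.rep.Kval *
        LinearMap.dualMap (-(M.rep.Kval * M.rep.F)))) = _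
      rw [show M.dual.rep.Kval = LinearMap.dualMap M.rep.Kinv from dualRep_Kval M.rep,
        ← dualMap_mul, ← dualMap_neg, neg_mul, neg_neg]
    rw [h2]
    refine LinearMap.ext fun v => ?_
    exact congrArg (Module.Dual.eval ℂ M) (LinearMap.congr_fun h v)
  map_x := by
    have h : ((M.rep.K ^ (1 - (l : ℤ)) : (Module.End ℂ M)ˣ) : Module.End ℂ M) * M.rep.x =
        M.rep.x * ((M.rep.K ^ (1 - (l : ℤ)) : (Module.End ℂ M)ˣ) : Module.End ℂ M) :=
      (Commute.units_zpow_left (show Commute (M.rep.K : Module.End ℂ M) (M.rep.x : Module.End ℂ M)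
        from M.rep.x_comm_Kval.symm) _).eq
    refine LinearMap.ext fun v => ?_
    exact congrArg (Module.Dual.eval ℂ M) (LinearMap.congr_fun h v)
  map_P i := by
    have h : ((M.rep.K ^ (1 - (l : ℤ)) : (Module.End ℂ M)ˣ) : Module.End ℂ M) * M.rep.P i =
        M.rep.P i * ((M.rep.K ^ (1 - (l : ℤ)) : (Module.End ℂ M)ˣ) : Module.End ℂ M) :=
      (Commute.units_zpow_left (show Commute (M.rep.K : Module.End ℂ M) (M.rep.P i)
        from M.rep.Kval_comm_P i) _).eq
    have h2 : M.dual.dual.rep.P i = LinearMap.dualMap (LinearMap.dualMap (M.rep.P i)) := by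
      change LinearMap.dualMap (LinearMap.dualMap (M.rep.P (- -i))) = _
      rw [neg_neg]
    rw [h2]
    refine LinearMap.ext fun v => ?_
    exact congrArg (Module.Dual.eval ℂ M) (LinearMap.congr_fun h v)

/-- `(id_V ⊗ tr_V)(f)` for an endomorphism `f` of `V ⊗ V`: the composition
`V → V ⊗ (V ⊗ V*) = (V ⊗ V) ⊗ V* → (V ⊗ V) ⊗ V* = V ⊗ (V ⊗ V*) → V ⊗ (V** ⊗ V*) → V`
of `id ⊗ coev`, `f ⊗ id`, `id ⊗ (μ ⊗ id)` and `id ⊗ ev`. -/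
noncomputable def rightPartialTrace (f : M.tensor M →ₗ[ℂ] M.tensor M) : M →ₗ[ℂ] M :=
  (TensorProduct.rid ℂ M).toLinearMap ∘ₗ
    M.dual.ev.lTensor M ∘ₗ
    (M.mu.toLinearMap.rTensor M.dual).lTensor M ∘ₗ
    (TensorProduct.assoc ℂ M M M.dual).toLinearMap ∘ₗ
    f.rTensor M.dual ∘ₗ
    (TensorProduct.assoc ℂ M M M.dual).symm.toLinearMap ∘ₗ
    M.coev.lTensor M ∘ₗ
    (TensorProduct.rid ℂ M).symm.toLinearMap

/-- `(tr_V ⊗ id_V)(f)` for an endomorphism `f` of `V ⊗ V`: the composition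
`V → (V* ⊗ V**) ⊗ V → (V* ⊗ V) ⊗ V = V* ⊗ (V ⊗ V) → V* ⊗ (V ⊗ V) = (V* ⊗ V) ⊗ V → V`
of `coev ⊗ id`, `(id ⊗ μ⁻¹) ⊗ id`, `id ⊗ f` and `ev ⊗ id`. -/
noncomputable def leftPartialTrace (f : M.tensor M →ₗ[ℂ] M.tensor M) : M →ₗ[ℂ] M :=
  (TensorProduct.lid ℂ M).toLinearMap ∘ₗ
    M.ev.rTensor M ∘ₗ
    (TensorProduct.assoc ℂ M.dual M M).symm.toLinearMap ∘ₗ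
    f.lTensor M.dual ∘ₗ
    (TensorProduct.assoc ℂ M.dual M M).toLinearMap ∘ₗ
    (M.mu.symm.toLinearMap.lTensor M.dual).rTensor M ∘ₗ
    M.dual.coev.rTensor M ∘ₗ
    (TensorProduct.lid ℂ M).symm.toLinearMap

/-- A module `V` is ambidextrous if the two partial traces of every endomorphism of the module
`V ⊗ V` agree. -/
def IsAmbidextrous : Prop :=
  ∀ f : M.tensor M →ₗ[ℂ] M.tensor M, IsHom (M.tensor M) (M.tensor M) f →
    M.rightPartialTrace f = M.leftPartialTrace f

end Trace

/-! ### The modules `V(a, k)` -/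

/-- `M` is the module `V(a, k)`: it is simple, and it has a highest weight vector `v` with
`E v = 0`, `x v = a v`, `P j v = δ_{j,k} v` and `M = ∑_{0 ≤ i < l} ℂ Fⁱ v`. -/
structure IsV (M : SplitModule.{u} m l) (a : ℂˣ) (k : ℤ) : Prop where
  simple : M.IsSimple
  highestWeight : ∃ v : M, v ≠ 0 ∧ M.rep.E v = 0 ∧
    (M.rep.x : Module.End ℂ M) v = (a : ℂ) • v ∧
    (∀ j, M.rep.P j v = if j = k then v else 0) ∧
    Submodule.span ℂ (Set.range fun i : Fin l => (M.rep.F ^ (i : ℕ)) v) = ⊤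

section Model

/-- The scalar `([i] (a² ε^{k+1-i} - a⁻² ε^{-(k+1-i)})) / (ε - ε⁻¹)` by which `E` sends `Fⁱ v` to
`Fⁱ⁻¹ v`. -/
noncomputable def coeffE (m l : ℕ) (a : ℂˣ) (k : ℤ) (i : ℕ) : ℂ :=
  (eps m l ^ (i : ℤ) - eps m l ^ (-(i : ℤ))) / (eps m l - (eps m l)⁻¹) *
    (((a : ℂ) ^ 2 * eps m l ^ (k + 1 - i) - ((a : ℂ) ^ 2 * eps m l ^ (k + 1 - i))⁻¹) /
      (eps m l - (eps m l)⁻¹))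

theorem coeffE_zero (m l : ℕ) (a : ℂˣ) (k : ℤ) : coeffE m l a k 0 = 0 := by
  simp [coeffE]

theorem coeffE_l (m l : ℕ) (a : ℂˣ) (k : ℤ) : coeffE m l a k l = 0 := by
  have h : eps m l ^ (l : ℤ) = eps m l ^ (-(l : ℤ)) := by
    rw [zpow_neg]
    apply eq_inv_of_mul_eq_one_left
    rw [zpow_natCast, ← mul_pow, ← pow_two, eps_pow]
  rw [coeffE, h, sub_self, zero_div, zero_mul]

theorem coeffE_succ_sub (m l : ℕ) (a : ℂˣ) (k : ℤ) (i : ℕ) :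
    coeffE m l a k (i + 1) - coeffE m l a k i = (eps m l - (eps m l)⁻¹)⁻¹ *
      (eps m l ^ (k - 2 * i) * (a : ℂ) ^ 2 - eps m l ^ (-(k - 2 * i)) * ((a : ℂ)⁻¹) ^ 2) := by
  have h0 := eps_ne_zero m l
  have ha : (a : ℂ) ≠ 0 := a.ne_zero
  by_cases hd : eps m l - (eps m l)⁻¹ = 0
  · simp [coeffE, hd]
  · have hX : eps m l ^ (i : ℤ) ≠ 0 := zpow_ne_zero _ h0
    have hY : eps m l ^ k ≠ 0 := zpow_ne_zero _ h0
    simp only [coeffE, Nat.cast_add, Nat.cast_one]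
    rw [show k + 1 - ((i : ℤ) + 1) = k - i by ring, show k - 2 * (i : ℤ) = k - i - i by ring]
    rw [div_mul_div_comm, div_mul_div_comm, ← sub_div, inv_mul_eq_div,
      div_eq_div_iff (mul_ne_zero hd hd) hd]
    simp only [zpow_sub₀ h0, zpow_add₀ h0, zpow_neg, zpow_one]
    have hd' : eps m l ^ 2 - 1 ≠ 0 := by
      intro h
      apply hd
      rw [sub_eq_zero]
      apply eq_inv_of_mul_eq_one_left
      rw [← pow_two]
      exact sub_eq_zero.mp h
    generalize eps m l ^ (i : ℤ) = X at *
    generalize eps m l ^ k = Y at *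
    generalize eps m l = e at *
    field_simp
    ring

variable (m l) (a : ℂˣ) (k : ℤ)

/-- `E` in the basis `v, F v, …, F^{l-1} v`. -/
noncomputable def modelE : Module.End ℂ (Fin l → ℂ) where
  toFun f i := if h : (i : ℕ) + 1 < l then coeffE m l a k (i + 1) * f ⟨i + 1, h⟩ else 0
  map_add' f g := by ext i; simp only [Pi.add_apply]; split_ifs <;> ring
  map_smul' c f := by
    ext i; simp only [Pi.smul_apply, smul_eq_mul, RingHom.id_apply]; split_ifs <;> ring

/-- `F` in the basis `v, F v, …, F^{l-1} v`. -/
noncomputable def modelF : Module.End ℂ (Fin l → ℂ) where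
  toFun f i := if 0 < (i : ℕ) then f ⟨i - 1, by omega⟩ else 0
  map_add' f g := by ext i; simp only [Pi.add_apply]; split_ifs <;> ring
  map_smul' c f := by
    ext i; simp only [Pi.smul_apply, smul_eq_mul, RingHom.id_apply]; split_ifs <;> ring

/-- `P j` in the basis `v, F v, …, F^{l-1} v`. -/
noncomputable def modelP (j : ℤ) : Module.End ℂ (Fin l → ℂ) where
  toFun f i := if j = k - 2 * (i : ℕ) then f i else 0
  map_add' f g := by ext i; simp only [Pi.add_apply]; split_ifs <;> ring
  map_smul' c f := by
    ext i; simp only [Pi.smul_apply, smul_eq_mul, RingHom.id_apply]; split_ifs <;> ring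

theorem modelE_apply (f : Fin l → ℂ) (i : Fin l) : modelE m l a k f i =
    if h : (i : ℕ) + 1 < l then coeffE m l a k (i + 1) * f ⟨i + 1, h⟩ else 0 := rfl

theorem modelF_apply (f : Fin l → ℂ) (i : Fin l) : modelF l f i =
    if 0 < (i : ℕ) then f ⟨i - 1, by omega⟩ else 0 := rfl

theorem modelP_apply (j : ℤ) (f : Fin l → ℂ) (i : Fin l) : modelP l k j f i =
    if j = k - 2 * (i : ℕ) then f i else 0 := rfl

theorem modelP_finite : (Function.support (modelP l k)).Finite := by
  refine (Set.finite_range fun i : Fin l => k - 2 * ((i : ℕ) : ℤ)).subset fun j hj => ?_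
  by_contra h
  apply hj
  refine LinearMap.ext fun f => funext fun i => ?_
  rw [modelP_apply, if_neg fun hji => h ⟨i, hji.symm⟩]
  rfl

theorem modelP_finsum (c : ℤ → ℂ) (f : Fin l → ℂ) (i : Fin l) :
    (∑ᶠ j, c j • modelP l k j) f i = c (k - 2 * (i : ℕ)) * f i := by
  have hf : (Function.support fun j => c j • modelP l k j).Finite :=
    (modelP_finite l k).subset fun j hj h0 => hj (by simp [h0])
  have h := AddMonoidHom.map_finsum (AddMonoidHom.mk'
    (fun X : Module.End ℂ (Fin l → ℂ) => X f i) (fun X Y => rfl)) hf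
  refine h.trans ?_
  rw [finsum_eq_single _ (k - 2 * (i : ℕ))]
  · simp [modelP_apply]
  · intro j hj
    simp [modelP_apply, hj]

theorem modelP_weights : IsWeightSystem (modelP l k) where
  mul i j := by
    refine LinearMap.ext fun f => funext fun n => ?_
    rw [Module.End.mul_apply, modelP_apply, modelP_apply]
    by_cases h : i = j
    · rw [if_pos h, modelP_apply, h]
      split_ifs <;> rfl
    · rw [if_neg h]
      by_cases hi : i = k - 2 * (n : ℕ)
      · rw [if_pos hi, if_neg (by omega)]; rfl
      · rw [if_neg hi]; rfl
  finite := modelP_finite l k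
  sum := by
    refine LinearMap.ext fun f => funext fun n => ?_
    have h := modelP_finsum l k (fun _ => 1) f n
    simpa using h

/-- A model of `V(a, k)` on `ℂˡ`. -/
noncomputable def modelRep : Rep m l (Module.End ℂ (Fin l → ℂ)) where
  E := modelE m l a k
  F := modelF l
  x := Units.map (algebraMap ℂ (Module.End ℂ (Fin l → ℂ))).toMonoidHom a
  P := modelP l k
  x_comm_E := Algebra.commutes _ _
  x_comm_F := Algebra.commutes _ _
  x_comm_P _ := Algebra.commutes _ _
  weights := modelP_weights l k
  P_mul_E j := by
    refine LinearMap.ext fun f => funext fun i => ?_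
    rw [Module.End.mul_apply, Module.End.mul_apply, modelP_apply, modelE_apply, modelE_apply]
    by_cases h : (i : ℕ) + 1 < l
    · rw [dif_pos h, dif_pos h, modelP_apply]
      by_cases hj : j = k - 2 * (i : ℕ)
      · rw [if_pos hj, if_pos (by push_cast; omega)]
      · rw [if_neg hj, if_neg (by push_cast; omega), mul_zero]
    · rw [dif_neg h, dif_neg h, ite_self]
  P_mul_F j := by
    refine LinearMap.ext fun f => funext fun i => ?_
    rw [Module.End.mul_apply, Module.End.mul_apply, modelP_apply, modelF_apply, modelF_apply]
    by_cases h : 0 < (i : ℕ)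
    · rw [if_pos h, if_pos h, modelP_apply]
      by_cases hj : j = k - 2 * (i : ℕ)
      · rw [if_pos hj, if_pos (by push_cast [Nat.cast_sub h]; omega)]
      · rw [if_neg hj, if_neg (by push_cast [Nat.cast_sub h]; omega)]
    · rw [if_neg h, if_neg h, ite_self]
  E_mul_F_sub := by
    have h1 : ∀ j : ℤ, (eps m l - (eps m l)⁻¹)⁻¹ •
        (eps m l ^ j • (algebraMap ℂ (Module.End ℂ (Fin l → ℂ)) a) ^ 2 -
          eps m l ^ (-j) • (algebraMap ℂ (Module.End ℂ (Fin l → ℂ)) ((a⁻¹ : ℂˣ) : ℂ)) ^ 2) *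
          modelP l k j =
        ((eps m l - (eps m l)⁻¹)⁻¹ *
          (eps m l ^ j * (a : ℂ) ^ 2 - eps m l ^ (-j) * ((a : ℂ)⁻¹) ^ 2)) • modelP l k j := by
      intro j
      rw [← map_pow, ← map_pow, ← algebraMap_smul (Module.End ℂ (Fin l → ℂ)) (eps m l ^ j),
        ← algebraMap_smul (Module.End ℂ (Fin l → ℂ)) (eps m l ^ (-j)), smul_eq_mul, smul_eq_mul,
        ← map_mul, ← map_mul, ← map_sub, smul_mul_assoc, ← Algebra.smul_def, smul_smul,
        Units.val_inv_eq_inv_val]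
    refine Eq.trans ?_ (finsum_congr fun j => (h1 j).symm)
    refine LinearMap.ext fun f => funext fun i => ?_
    rw [modelP_finsum, ← coeffE_succ_sub, LinearMap.sub_apply, Pi.sub_apply, Module.End.mul_apply,
      Module.End.mul_apply, modelE_apply, modelF_apply, sub_mul]
    congr 1
    · by_cases h : (i : ℕ) + 1 < l
      · rw [dif_pos h, modelF_apply, if_pos (Nat.succ_pos _)]
        rfl
      · have hl : (i : ℕ) + 1 = l := by omega
        rw [dif_neg h, hl, coeffE_l, zero_mul]
    · by_cases h : 0 < (i : ℕ)
      · rw [if_pos h, modelE_apply, dif_pos (by simp; omega)]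
        have e : (i : ℕ) - 1 + 1 = i := by omega
        simp only [e]
      · have hi : (i : ℕ) = 0 := by omega
        rw [if_neg h, hi, coeffE_zero, zero_mul]

/-- The module with underlying space `ℂˡ` that realizes `V(a, k)`. -/
noncomputable abbrev model : SplitModule.{0} m l where
  carrier := Fin l → ℂ
  rep := modelRep m l a k

variable {m l}

theorem eps_sq_pow_ne_one (hml : Nat.Coprime m l) {i : ℕ} (hi : 0 < i) (hil : i < l) :
    (eps m l ^ 2) ^ i ≠ 1 := by
  have hl : (l : ℂ) ≠ 0 := Nat.cast_ne_zero.mpr (by omega)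
  rw [eps, tpar, ← pow_mul, ← pow_mul, ← Complex.exp_nat_mul, ne_eq, Complex.exp_eq_one_iff]
  rintro ⟨n, hn⟩
  have hpi : (2 * Real.pi * Complex.I : ℂ) ≠ 0 := Complex.two_pi_I_ne_zero
  have h1 : ((m * i : ℕ) : ℂ) = n * l := by
    push_cast at hn ⊢
    field_simp at hn
    apply mul_left_cancel₀ hpi
    linear_combination (2 * Real.pi * Complex.I) * hn
  have h2 : ((m * i : ℕ) : ℤ) = n * l := by exact_mod_cast h1
  have h3 : l ∣ m * i := by
    have : (l : ℤ) ∣ ((m * i : ℕ) : ℤ) := ⟨n, by rw [h2, mul_comm]⟩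
    exact_mod_cast this
  exact absurd (Nat.le_of_dvd hi (hml.symm.dvd_of_dvd_mul_left h3)) (by omega)

theorem coeffE_ne_zero (hl : 1 < l) (hml : Nat.Coprime m l) (ha : (a : ℂ) ^ (4 * l) ≠ 1)
    {i : ℕ} (hi : 0 < i) (hil : i < l) : coeffE m l a k i ≠ 0 := by
  have h0 := eps_ne_zero m l
  have hd : eps m l - (eps m l)⁻¹ ≠ 0 := by
    intro h
    apply eps_sq_pow_ne_one hml one_pos hl
    rw [pow_one, pow_two]
    nth_rewrite 1 [sub_eq_zero.mp h]
    exact inv_mul_cancel₀ h0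
  refine mul_ne_zero (div_ne_zero ?_ hd) (div_ne_zero ?_ hd)
  · intro h
    apply eps_sq_pow_ne_one hml hi hil
    rw [sub_eq_zero, zpow_neg] at h
    rw [pow_two, mul_pow, ← zpow_natCast]
    nth_rewrite 1 [h]
    exact inv_mul_cancel₀ (zpow_ne_zero _ h0)
  · intro h
    apply ha
    have hb : (a : ℂ) ^ 2 * eps m l ^ (k + 1 - (i : ℤ)) ≠ 0 :=
      mul_ne_zero (pow_ne_zero _ a.ne_zero) (zpow_ne_zero _ h0)
    have h1 : ((a : ℂ) ^ 2 * eps m l ^ (k + 1 - (i : ℤ))) ^ 2 = 1 := by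
      rw [pow_two]
      nth_rewrite 1 [sub_eq_zero.mp h]
      exact inv_mul_cancel₀ hb
    have h2 := congrArg (· ^ l) h1
    simp only [one_pow] at h2
    have h3 : (((a : ℂ) ^ 2 * eps m l ^ (k + 1 - (i : ℤ))) ^ 2) ^ l =
        (a : ℂ) ^ (4 * l) * (((eps m l) ^ 2) ^ l) ^ (k + 1 - (i : ℤ)) := by
      rw [mul_pow, mul_pow, ← pow_mul, ← pow_mul]
      congr 1
      · congr 1; ring
      · rw [← zpow_natCast, ← zpow_natCast, ← zpow_natCast, ← zpow_natCast, ← zpow_mul, ← zpow_mul,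
          ← zpow_mul, ← zpow_mul]
        congr 1
        ring
    rw [h3, eps_pow, one_zpow, mul_one] at h2
    exact h2

theorem modelF_pow_single (h0 : 0 < l) (i : ℕ) (hi : i < l) :
    (modelF l ^ i) (Pi.single ⟨0, h0⟩ 1) = Pi.single ⟨i, hi⟩ 1 := by
  induction i with
  | zero => rfl
  | succ n ih =>
    rw [pow_succ', Module.End.mul_apply, ih (by omega)]
    ext j
    rw [modelF_apply, Pi.single_apply, Pi.single_apply]
    by_cases hj : 0 < (j : ℕ)
    · rw [if_pos hj]
      congr 1
      simp only [Fin.ext_iff]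
      exact propext ⟨fun h => by omega, fun h => by omega⟩
    · rw [if_neg hj, if_neg]
      intro h
      rw [h] at hj
      simp at hj

/-- The module `V(a, k)` exists for every generic `a`. -/
theorem model_isV (hl : 1 < l) (hml : Nat.Coprime m l) (ha : (a : ℂ) ^ (4 * l) ≠ 1) :
    (model m l a k).IsV a k where
  simple := by
    have h0 : 0 < l := by omega
    have : Nonempty (Fin l) := ⟨⟨0, h0⟩⟩
    refine ⟨inferInstanceAs (Nontrivial (Fin l → ℂ)), fun W hE hF _ _ hP => ?_⟩
    rw [or_iff_not_imp_left]
    intro hW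
    obtain ⟨w, hw, hw0⟩ := Submodule.exists_mem_ne_zero_of_ne_bot hW
    obtain ⟨i, hi⟩ : ∃ i : Fin l, (w : Fin l → ℂ) i ≠ 0 := by
      by_contra h
      push Not at h
      exact hw0 (funext h)
    have hsingle : ∀ n (hn : n < l), (Pi.single ⟨n, hn⟩ 1 : Fin l → ℂ) ∈ W →
        (Pi.single ⟨0, h0⟩ 1 : Fin l → ℂ) ∈ W := by
      intro n
      induction n with
      | zero => exact fun _ h => h
      | succ n ih =>
        intro hn h
        apply ih (by omega)
        have h1 := W.smul_mem (coeffE m l a k (n + 1))⁻¹ (hE _ h)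
        refine Eq.mp (congrArg (· ∈ W) (Eq.symm (funext fun j => ?_))) h1
        change _ = (coeffE m l a k (n + 1))⁻¹ * modelE m l a k (Pi.single ⟨n + 1, hn⟩ 1) j
        rw [modelE_apply, Pi.single_apply]
        by_cases hj : j = ⟨n, by omega⟩
        · subst hj
          rw [if_pos rfl, dif_pos hn, Pi.single_eq_same, mul_one,
            inv_mul_cancel₀ (coeffE_ne_zero a k hl hml ha (Nat.succ_pos n) hn)]
        · rw [if_neg hj]
          split_ifs with h2
          · rw [Pi.single_eq_of_ne, mul_zero, mul_zero]
            intro h3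
            apply hj
            simp only [Fin.ext_iff] at h3 ⊢
            omega
          · rw [mul_zero]
    have hi' : (Pi.single i 1 : Fin l → ℂ) ∈ W := by
      have h1 := W.smul_mem ((w : Fin l → ℂ) i)⁻¹ (hP (k - 2 * (i : ℕ)) w hw)
      refine Eq.mp (congrArg (· ∈ W) (Eq.symm (funext fun j => ?_))) h1
      change (Pi.single i 1 : Fin l → ℂ) j = ((w : Fin l → ℂ) i)⁻¹ *
        (if k - 2 * ((i : ℕ) : ℤ) = k - 2 * ((j : ℕ) : ℤ) then (w : Fin l → ℂ) j else 0)
      rw [Pi.single_apply]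
      by_cases hj : j = i
      · rw [if_pos hj, hj, if_pos rfl, inv_mul_cancel₀ hi]
      · rw [if_neg hj, if_neg, mul_zero]
        intro h
        exact hj (Fin.ext (by omega))
    have hz := hsingle i i.2 hi'
    have hall : ∀ n (hn : n < l), (Pi.single ⟨n, hn⟩ 1 : Fin l → ℂ) ∈ W := by
      intro n hn
      rw [← modelF_pow_single h0 n hn]
      clear hn
      induction n with
      | zero => exact hz
      | succ n ih =>
        rw [pow_succ', Module.End.mul_apply]
        exact hF _ ih
    rw [eq_top_iff]
    intro f _
    have hf : (f : Fin l → ℂ) = ∑ i, (f : Fin l → ℂ) i • (Pi.single i 1 : Fin l → ℂ) :=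
      pi_eq_sum_univ' f
    rw [hf]
    exact W.sum_mem fun i _ => W.smul_mem _ (hall i i.2)
  highestWeight := by
    have h0 : 0 < l := by omega
    refine ⟨(Pi.single ⟨0, h0⟩ 1 : Fin l → ℂ), ?_, ?_, ?_, ?_, ?_⟩
    · intro h
      have h1 : (Pi.single ⟨0, h0⟩ 1 : Fin l → ℂ) ⟨0, h0⟩ = 0 := congrFun h ⟨0, h0⟩
      rw [Pi.single_eq_same] at h1
      exact one_ne_zero h1
    · refine funext fun i => ?_
      change modelE m l a k (Pi.single ⟨0, h0⟩ 1) i = 0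
      rw [modelE_apply]
      split_ifs with h
      · rw [Pi.single_eq_of_ne (by simp [Fin.ext_iff]), mul_zero]
      · rfl
    · rfl
    · intro j
      have h1 : ∀ i, modelP l k j (Pi.single ⟨0, h0⟩ 1) i =
          if j = k then (Pi.single ⟨0, h0⟩ 1 : Fin l → ℂ) i else 0 := by
        intro i
        rw [modelP_apply]
        by_cases hi : i = ⟨0, h0⟩
        · subst hi
          simp only [Nat.cast_zero, mul_zero, sub_zero]
        · rw [Pi.single_eq_of_ne hi, ite_self, ite_self]
      by_cases hj : j = k
      · exact Eq.trans (funext fun i => (h1 i).trans (if_pos hj)) (if_pos hj).symm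
      · exact Eq.trans (funext fun i => (h1 i).trans (if_neg hj)) (if_neg hj).symm
    · rw [eq_top_iff]
      intro f _
      have hf : (f : Fin l → ℂ) = ∑ i, (f : Fin l → ℂ) i • (Pi.single i 1 : Fin l → ℂ) :=
        pi_eq_sum_univ' f
      rw [hf]
      refine Submodule.sum_mem _ fun i _ => Submodule.smul_mem _ _ (Submodule.subset_span ⟨i, ?_⟩)
      exact modelF_pow_single h0 i i.2

end Model

end SplitModule
end SplitSl2

/-! Write `l = n + 1`, `q = ε²`, and let `bᵢ = Fⁱv` for `0 ≤ i ≤ n` be the basis generated by the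
highest weight vector. Both partial traces are composed of morphisms, so they commute with `F` and
`K⁻¹`. The `bᵢ` have pairwise distinct `K⁻¹`-eigenvalues and arise from `b₀` by applying `F`, so any
such map is a scalar (`exists_eq_smul_of_commute`). It is therefore enough to know one diagonal
coefficient of each trace, and the two coefficients may be taken at different vectors: at the
highest weight vector `b₀` on the right, at the lowest one `bₙ` on the left.

At `b₀` the right trace is the sum over `i` of `κᵢⁿ ⟨b₀* ⊗ bᵢ*, f(b₀ ⊗ bᵢ)⟩`, where `κᵢ = γqⁱ` is
the eigenvalue of `K⁻¹` on `bᵢ`, because `K^(1-l) = (K⁻¹)ⁿ`. Let `T = F ⊗ 1 + K⁻¹ ⊗ F`. By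
`horner_skew`, a combination of the vectors `Tˢ(b₀ ⊗ bₙ₋ₛ)` has Gaussian binomials of top index `n +
1` as coefficients; at a primitive root of order `n + 1` all of these but one vanish, and a multiple
of `bₙ ⊗ b₀` is left. Since `f` commutes with `T`, and `b₀* ⊗ bₙ*` composed with `Tˢ` is `γˢ b₀* ⊗
bₙ₋ₛ*`, the weighted sum collapses to the single coefficient `⟨b₀* ⊗ bₙ*, f(bₙ ⊗ b₀)⟩`
(`sum_coord_eq_of_commute`). The ribbon weights `κᵢⁿ` are exactly the ones that this needs.

For the left trace, exchange the tensor factors and use `E`, `K` and the basis generated by `E` from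
`bₙ`. The same identity gives a corner coefficient which, up to scalings that cancel, is again `⟨b₀*
⊗ bₙ*, f(bₙ ⊗ b₀)⟩`. Hence the two scalars agree. -/

namespace SplitSl2

/-! ### Gaussian binomial coefficients -/

section GaussBinom

variable {R : Type*} [CommRing R] (q : R)

/-- The Gaussian binomial coefficient, by its Pascal rule. -/
def gaussBinom : ℕ → ℕ → R
  | _, 0 => 1
  | 0, _ + 1 => 0
  | n + 1, k + 1 => gaussBinom n k + q ^ (k + 1) * gaussBinom n (k + 1)

theorem gaussBinom_zero_right (n : ℕ) : gaussBinom q n 0 = 1 := by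
  cases n <;> rfl

theorem gaussBinom_zero_succ (k : ℕ) : gaussBinom q 0 (k + 1) = 0 := rfl

theorem gaussBinom_succ_succ (n k : ℕ) : gaussBinom q (n + 1) (k + 1) =
    gaussBinom q n k + q ^ (k + 1) * gaussBinom q n (k + 1) := rfl

theorem gaussBinom_eq_zero_of_lt (n : ℕ) : ∀ k, n < k → gaussBinom q n k = 0 := by
  induction n with
  | zero =>
    intro k hk
    obtain ⟨k, rfl⟩ := Nat.exists_eq_succ_of_ne_zero hk.ne'
    rfl
  | succ n ih =>
    intro k hk
    obtain ⟨k, rfl⟩ := Nat.exists_eq_succ_of_ne_zero (Nat.ne_zero_of_lt hk)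
    rw [gaussBinom_succ_succ, ih k (by omega), ih (k + 1) (by omega), mul_zero, add_zero]

theorem gaussBinom_self (n : ℕ) : gaussBinom q n n = 1 := by
  induction n with
  | zero => rfl
  | succ n ih =>
    rw [gaussBinom_succ_succ, ih, gaussBinom_eq_zero_of_lt q n (n + 1) (by omega), mul_zero,
      add_zero]

/-- The `q`-analogue of absorption for binomial coefficients, with denominators cleared so that it
survives specialization to roots of unity. -/
theorem gaussBinom_absorb (n : ℕ) : ∀ k, gaussBinom q (n + 1) (k + 1) * (1 - q ^ (k + 1)) =
    (1 - q ^ (n + 1)) * gaussBinom q n k := by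
  induction n with
  | zero =>
    intro k
    cases k with
    | zero => simp [gaussBinom_succ_succ, gaussBinom_zero_right, gaussBinom_zero_succ]
    | succ k => simp [gaussBinom_succ_succ, gaussBinom_zero_succ]
  | succ n ih =>
    intro k
    have h1 := ih k
    cases k with
    | zero =>
      rw [gaussBinom_succ_succ]
      simp only [gaussBinom_zero_right] at h1 ⊢
      linear_combination q * h1
    | succ k =>
      have h2 := ih k
      rw [gaussBinom_succ_succ q (n + 1) (k + 1)]
      have h3 := gaussBinom_succ_succ q n k
      -- The splitting `1 - q^(k+2) = (1 - q) + q(1 - q^(k+1))` makes `h2` applicable; Pascal's rule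
      -- `h3` then recombines the two lower binomials.
      linear_combination q ^ (k + 2) * h1 - q * (1 - q ^ (n + 1)) * h3 + q * h2

/-- In the absorption identity the factor `1 - q^l` is zero while `1 - q^k` is not, and a domain
allows cancelling the latter. -/
theorem gaussBinom_eq_zero_of_pow_eq_one [IsDomain R] {l : ℕ} (hq : IsPrimitiveRoot q l) {k : ℕ}
    (hk : 0 < k) (hkl : k < l) : gaussBinom q l k = 0 := by
  obtain ⟨k, rfl⟩ := Nat.exists_eq_succ_of_ne_zero hk.ne'
  obtain ⟨l, rfl⟩ := Nat.exists_eq_succ_of_ne_zero (Nat.ne_zero_of_lt hkl)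
  have h := gaussBinom_absorb q l k
  rw [Nat.succ_eq_add_one] at hq
  rw [hq.pow_eq_one, sub_self, zero_mul] at h
  exact (mul_eq_zero.mp h).resolve_right
    (sub_ne_zero.mpr (hq.pow_ne_one_of_pos_of_lt hk.ne' hkl).symm)

end GaussBinom

/-! ### Endomorphisms that commute with a skew primitive operator -/

section SkewPrimitive

open TensorProduct

variable {K V : Type*} [Field K] [AddCommGroup V] [Module K V] {G H : Module.End K V} {γ q : K}
  {e : ℕ → V}

/-- The operator `G ⊗ 1 + H ⊗ G`. -/
def skewOp (G H : Module.End K V) : Module.End K (V ⊗[K] V) := map G 1 + map H G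

/-- If `Sₙ` is the left side and `T` the skew operator, then `Sₙ₊₁ = e₀ ⊗ eₙ₊₁ + (q/γ) T Sₙ`, as in
Horner's scheme. `T` sends `eᵢ ⊗ eⱼ` to its two neighbours, the second with factor `γqⁱ`; the
normalization `q/γ` turns this into `q^(i+1)`, the weight in Pascal's rule. -/
theorem horner_skew (hγ : γ ≠ 0) (hG : ∀ i, G (e i) = e (i + 1))
    (hH : ∀ i, H (e i) = (γ * q ^ i) • e i) (n : ℕ) :
    ∑ s ∈ Finset.range (n + 1),
      (q / γ) ^ s • (skewOp G H ^ s) (e 0 ⊗ₜ[K] e (n - s)) =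
    ∑ i ∈ Finset.range (n + 1),
      ((q / γ) ^ i * gaussBinom q (n + 1) (i + 1)) • (e i ⊗ₜ[K] e (n - i)) := by
  have hT : ∀ i j, skewOp G H (e i ⊗ₜ[K] e j) =
      e (i + 1) ⊗ₜ e j + (γ * q ^ i) • (e i ⊗ₜ e (j + 1)) := by
    intro i j
    rw [skewOp, LinearMap.add_apply, map_tmul, map_tmul, hG, hG, hH, smul_tmul',
      Module.End.one_apply]
  induction n with
  | zero => simp [gaussBinom_self]
  | succ n ih =>
    rw [Finset.sum_range_succ']
    have h3 : ∀ s, (q / γ) ^ (s + 1) • (skewOp G H ^ (s + 1)) (e 0 ⊗ₜ[K] e (n + 1 - (s + 1))) =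
        (q / γ) • skewOp G H ((q / γ) ^ s • (skewOp G H ^ s) (e 0 ⊗ₜ[K] e (n - s))) := by
      intro s
      rw [Nat.add_sub_add_right, pow_succ', pow_succ', mul_smul, Module.End.mul_apply, map_smul]
    simp only [h3]
    rw [← Finset.smul_sum, ← map_sum, ih, map_sum, Finset.smul_sum]
    have h1 : ∀ i ∈ Finset.range (n + 1), (q / γ) • skewOp G H
        (((q / γ) ^ i * gaussBinom q (n + 1) (i + 1)) • (e i ⊗ₜ[K] e (n - i))) =
        ((q / γ) ^ (i + 1) * gaussBinom q (n + 1) (i + 1)) • (e (i + 1) ⊗ₜ e (n + 1 - (i + 1))) +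
        ((q / γ) ^ i * (q ^ (i + 1) * gaussBinom q (n + 1) (i + 1))) •
          (e i ⊗ₜ e (n + 1 - i)) := by
      intro i hi
      have hi' : n - i + 1 = n + 1 - i := by
        have := Finset.mem_range.mp hi
        omega
      rw [map_smul, hT, smul_add, smul_add, smul_smul, smul_smul, smul_smul, hi',
        Nat.add_sub_add_right]
      congr 2
      · ring
      · field_simp
        ring
    rw [Finset.sum_congr rfl h1, Finset.sum_add_distrib]
    have h2 : ∀ i ∈ Finset.range (n + 1 + 1), ((q / γ) ^ i *
        gaussBinom q (n + 1 + 1) (i + 1)) • (e i ⊗ₜ[K] e (n + 1 - i)) =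
        ((q / γ) ^ i * gaussBinom q (n + 1) i) • (e i ⊗ₜ e (n + 1 - i)) +
        ((q / γ) ^ i * (q ^ (i + 1) * gaussBinom q (n + 1) (i + 1))) •
          (e i ⊗ₜ e (n + 1 - i)) := by
      intro i _
      rw [gaussBinom_succ_succ, mul_add, add_smul]
    -- The first Pascal half is shifted by one index, its term `i = 0` being the separate summand
    -- `e₀ ⊗ eₙ₊₁`. The second half loses its top term, whose binomial vanishes.
    rw [← Finset.sum_congr rfl (fun i hi => (h2 i hi).symm), Finset.sum_add_distrib,
      Finset.sum_range_succ' (fun i => ((q / γ) ^ i * gaussBinom q (n + 1) i) •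
        (e i ⊗ₜ[K] e (n + 1 - i))),
      Finset.sum_range_succ (fun i => ((q / γ) ^ i * (q ^ (i + 1) *
        gaussBinom q (n + 1) (i + 1))) • (e i ⊗ₜ[K] e (n + 1 - i))) (n + 1),
      gaussBinom_eq_zero_of_lt q (n + 1) (n + 1 + 1) (by omega)]
    simp only [gaussBinom_zero_right, pow_zero, mul_zero, zero_smul, add_zero, mul_one, one_smul,
      Nat.sub_zero, Module.End.one_apply]
    abel

/-- For `f` commuting with `G ⊗ 1 + H ⊗ G`, a weighted sum of diagonal matrix coefficients of `f`
is a single off-diagonal coefficient. -/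
theorem sum_coeff_eq_of_commute (hγ : γ ≠ 0) {n : ℕ} (hq : IsPrimitiveRoot q (n + 1))
    (hG : ∀ i, G (e i) = e (i + 1)) (hH : ∀ i, H (e i) = (γ * q ^ i) • e i)
    {φ : ℕ → Module.Dual K V} (h0 : φ 0 ∘ₗ G = 0) (hφH : φ 0 ∘ₗ H = γ • φ 0)
    (hφG : ∀ j < n, φ (j + 1) ∘ₗ G = φ j) {f : Module.End K (V ⊗[K] V)}
    (hf : f * skewOp G H = skewOp G H * f) :
    ∑ s ∈ Finset.range (n + 1), q ^ s *
      dualDistrib K V V (φ 0 ⊗ₜ φ (n - s)) (f (e 0 ⊗ₜ e (n - s))) =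
    (q / γ) ^ n * dualDistrib K V V (φ 0 ⊗ₜ φ n) (f (e n ⊗ₜ e 0)) := by
  -- Seen through `φ 0 ⊗ φ (j + 1)`, the summand `G ⊗ 1` disappears and `H ⊗ G` only lowers the
  -- second index, at the cost of a factor `γ`.
  have hT : ∀ j < n, ∀ y, dualDistrib K V V (φ 0 ⊗ₜ φ (j + 1)) (skewOp G H y) =
      γ * dualDistrib K V V (φ 0 ⊗ₜ φ j) y := by
    intro j hj y
    induction y with
    | zero => simp
    | add a b ha hb => rw [map_add, map_add, map_add, ha, hb, mul_add]
    | tmul x y =>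
      have e1 : φ 0 (G x) = 0 := LinearMap.congr_fun h0 x
      have e2 : φ 0 (H x) = γ * φ 0 x := LinearMap.congr_fun hφH x
      have e3 : φ (j + 1) (G y) = φ j y := LinearMap.congr_fun (hφG j hj) y
      rw [skewOp, LinearMap.add_apply, map_add, map_tmul, map_tmul, dualDistrib_apply,
        dualDistrib_apply, dualDistrib_apply, e1, e2, e3, zero_mul, zero_add, mul_assoc]
  have hTs : ∀ s ≤ n, ∀ y, dualDistrib K V V (φ 0 ⊗ₜ φ n) ((skewOp G H ^ s) y) =
      γ ^ s * dualDistrib K V V (φ 0 ⊗ₜ φ (n - s)) y := by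
    intro s
    induction s with
    | zero => simp
    | succ s ih =>
      intro hs y
      rw [pow_succ, Module.End.mul_apply, ih (by omega), show n - s = n - (s + 1) + 1 by omega,
        hT _ (by omega), pow_succ, mul_assoc]
  have hfs : ∀ s y, f ((skewOp G H ^ s) y) = (skewOp G H ^ s) (f y) :=
    fun s y => LinearMap.congr_fun (Commute.pow_right hf s) y
  -- Apply `f` and then `φ 0 ⊗ φ n` to the Horner identity. On the left the powers of the skew
  -- operator move past `f` onto the functional.
  have h := congrArg (fun y => dualDistrib K V V (φ 0 ⊗ₜ φ n) (f y)) (horner_skew hγ hG hH n)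
  simp only [map_sum, map_smul, smul_eq_mul, hfs] at h
  -- Only `i = n` survives on the right: the other Gaussian binomials vanish at the primitive root
  -- `q` of order `n + 1`.
  rw [Finset.sum_range_succ (fun i => (q / γ) ^ i * gaussBinom q (n + 1) (i + 1) *
    dualDistrib K V V (φ 0 ⊗ₜ φ n) (f (e i ⊗ₜ e (n - i)))), gaussBinom_self, mul_one, Nat.sub_self,
    Finset.sum_eq_zero (s := Finset.range n), zero_add] at h
  · rw [← h]
    refine Finset.sum_congr rfl fun s hs => ?_
    rw [hTs s (Nat.lt_succ_iff.mp (Finset.mem_range.mp hs)), ← mul_assoc, ← mul_pow,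
      div_mul_cancel₀ _ hγ]
  · intro i hi
    rw [gaussBinom_eq_zero_of_pow_eq_one q hq (Nat.succ_pos i)
      (Nat.succ_lt_succ (Finset.mem_range.mp hi)), mul_zero, zero_mul]

end SkewPrimitive
/-! ### Graded cyclic bases -/

section CyclicBasis

open TensorProduct

variable {K V : Type*} [Field K] [AddCommGroup V] [Module K V] {G H : Module.End K V} {γ q : K}
  {n : ℕ} {b : Module.Basis (Fin (n + 1)) K V}

theorem coord_comp_eq_smul {ι : Type*} {b : Module.Basis ι K V} {H : Module.End K V} {μ : ι → K}
    (hH : ∀ i, H (b i) = μ i • b i) (i : ι) : b.coord i ∘ₗ H = μ i • b.coord i := by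
  classical
  refine b.ext fun j => ?_
  rw [LinearMap.comp_apply, hH, map_smul, LinearMap.smul_apply, Module.Basis.coord_apply,
    Module.Basis.repr_self, Finsupp.single_apply]
  split_ifs with h
  · rw [h]
  · simp

/-- This is `sum_coeff_eq_of_commute` multiplied by `γⁿq`. The weights then become the `n`-th powers
of the eigenvalues of `H`, which is how the ribbon structure enters the partial traces. -/
theorem sum_coord_eq_of_commute (hγ : γ ≠ 0) (hq : IsPrimitiveRoot q (n + 1))
    (hG : ∀ i : Fin n, G (b i.castSucc) = b i.succ) (hGl : G (b (Fin.last n)) = 0)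
    (hH : ∀ i, H (b i) = (γ * q ^ (i : ℕ)) • b i) {f : Module.End K (V ⊗[K] V)}
    (hf : f * skewOp G H = skewOp G H * f) :
    ∑ i : Fin (n + 1), (γ * q ^ (i : ℕ)) ^ n *
      dualDistrib K V V (b.coord 0 ⊗ₜ b.coord i) (f (b 0 ⊗ₜ b i)) =
    dualDistrib K V V (b.coord 0 ⊗ₜ b.coord (Fin.last n)) (f (b (Fin.last n) ⊗ₜ b 0)) := by
  have hq0 : q ≠ 0 := hq.ne_zero (Nat.succ_ne_zero n)
  -- Extension by zero beyond `n` makes `G eᵢ = eᵢ₊₁` true for every `i`; at `i = n` it encodes `G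
  -- bₙ = 0`.
  set e : ℕ → V := fun i => if h : i < n + 1 then b ⟨i, h⟩ else 0
  set φ : ℕ → Module.Dual K V := fun i => if h : i < n + 1 then b.coord ⟨i, h⟩ else 0
  have heb : ∀ i : Fin (n + 1), e i = b i := fun i => dif_pos i.2
  have hφb : ∀ i : Fin (n + 1), φ i = b.coord i := fun i => dif_pos i.2
  have he0 : ∀ i, n + 1 ≤ i → e i = 0 := fun i hi => dif_neg (by omega)
  have hGe : ∀ i, G (e i) = e (i + 1) := by
    intro i
    rcases lt_trichotomy i n with h | h | h
    · rw [show e i = b (Fin.castSucc ⟨i, h⟩) from dif_pos (by omega), hG]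
      exact (heb (Fin.succ ⟨i, h⟩)).symm
    · rw [h, show e n = b (Fin.last n) from dif_pos (by omega), hGl, he0 (n + 1) le_rfl]
    · rw [he0 i h, map_zero, he0 (i + 1) (by omega)]
  have hHe : ∀ i, H (e i) = (γ * q ^ i) • e i := by
    intro i
    by_cases h : i < n + 1
    · rw [show e i = b ⟨i, h⟩ from dif_pos h, hH]
    · rw [show e i = 0 from dif_neg h, map_zero, smul_zero]
  have hφe : ∀ i j : Fin (n + 1), φ i (b j) = if i = j then 1 else 0 := by
    intro i j
    rw [hφb, Module.Basis.coord_apply, Module.Basis.repr_self, Finsupp.single_apply]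
    simp only [eq_comm]
  have h0 : φ 0 ∘ₗ G = 0 := by
    refine b.ext fun i => ?_
    rw [LinearMap.comp_apply, LinearMap.zero_apply]
    induction i using Fin.lastCases with
    | last => rw [hGl, map_zero]
    | cast i =>
      rw [hG]
      exact (hφe 0 i.succ).trans (if_neg (Fin.succ_ne_zero i).symm)
  have hφG : ∀ j < n, φ (j + 1) ∘ₗ G = φ j := by
    intro j hj
    refine b.ext fun i => ?_
    have e1 := hφe (Fin.succ ⟨j, hj⟩)
    have e2 := hφe (Fin.castSucc ⟨j, hj⟩)
    simp only [Fin.val_succ, Fin.val_castSucc] at e1 e2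
    rw [LinearMap.comp_apply, e2]
    induction i using Fin.lastCases with
    | last => rw [hGl, map_zero, if_neg (Fin.castSucc_lt_last _).ne]
    | cast i => simp only [hG, e1, Fin.succ_inj, Fin.castSucc_inj]
  have hφH : φ 0 ∘ₗ H = γ • φ 0 := by
    have h := coord_comp_eq_smul hH 0
    rw [← hφb 0, Fin.val_zero, pow_zero, mul_one] at h
    exact h
  have key := sum_coeff_eq_of_commute hγ hq hGe hHe h0 hφH hφG hf
  -- Reindex by `i = n - s`, so that the sum runs over the index of the second tensor factor.
  rw [← Finset.sum_range_reflect] at key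
  have hval : ∀ i : Fin (n + 1), n - (n + 1 - 1 - (i : ℕ)) = i := fun i => by omega
  rw [Finset.sum_range] at key
  simp only [hval, heb, hφb] at key
  rw [show e 0 = b 0 from heb 0, show φ 0 = b.coord 0 from hφb 0,
    show e n = b (Fin.last n) from heb (Fin.last n),
    show φ n = b.coord (Fin.last n) from hφb (Fin.last n)] at key
  -- Since `q^(n+1) = 1`, both `q^(in)` and `q · q^(n-i)` are the inverse of `qⁱ`.
  have hw : ∀ i : Fin (n + 1), (γ * q ^ (i : ℕ)) ^ n = γ ^ n * q * q ^ (n + 1 - 1 - (i : ℕ)) := by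
    intro i
    have hi : (i : ℕ) ≤ n := by omega
    have e1 : q ^ (i : ℕ) * q ^ (n + 1 - 1 - (i : ℕ)) = q ^ n := by
      rw [← pow_add]
      congr 1
      omega
    have e2 : (q ^ (i : ℕ)) ^ n * q ^ (i : ℕ) = 1 := by
      rw [← pow_succ, ← pow_mul, mul_comm, pow_mul, hq.pow_eq_one, one_pow]
    apply mul_right_cancel₀ (pow_ne_zero (i : ℕ) hq0)
    rw [mul_pow, mul_assoc, e2, mul_assoc, mul_comm _ (q ^ (i : ℕ)), e1, mul_assoc, ← pow_succ',
      hq.pow_eq_one]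
  simp only [hw, mul_assoc]
  -- The overall constant is `q^(n+1) = 1`, so the corner coefficient appears without a factor.
  have hc : γ ^ n * (q * (q / γ) ^ n) = 1 := by
    rw [mul_left_comm, ← mul_pow, mul_div_cancel₀ _ hγ, ← pow_succ', hq.pow_eq_one]
  rw [← Finset.mul_sum, ← Finset.mul_sum, key, ← mul_assoc q, ← mul_assoc, hc, one_mul]

/-- An endomorphism that commutes with the raising operator and the grading operator of a graded
cyclic basis is a scalar. -/
theorem exists_eq_smul_of_commute (hγ : γ ≠ 0) (hq : IsPrimitiveRoot q (n + 1))
    (hG : ∀ i : Fin n, G (b i.castSucc) = b i.succ)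
    (hH : ∀ i, H (b i) = (γ * q ^ (i : ℕ)) • b i) {g : Module.End K V}
    (hgG : g ∘ₗ G = G ∘ₗ g) (hgH : g ∘ₗ H = H ∘ₗ g) : ∃ c : K, ∀ w, g w = c • w := by
  -- `g (b 0)` lies in the `γ`-eigenspace of `H`, and the eigenvalues `γqⁱ` with `0 < i ≤ n` differ
  -- from `γ`; so this eigenspace is the line through `b 0`. From there `G` carries the scalar to
  -- all basis vectors.
  have h0 : g (b 0) = b.coord 0 (g (b 0)) • b 0 := by
    apply b.repr.injective
    ext i
    by_cases hi : i = 0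
    · subst hi
      simp
    · have h1 := LinearMap.congr_fun (coord_comp_eq_smul hH i) (g (b 0))
      have h2 : H (g (b 0)) = γ • g (b 0) := by
        rw [← LinearMap.comp_apply, ← hgH, LinearMap.comp_apply, hH, map_smul, Fin.val_zero,
          pow_zero, mul_one]
      rw [LinearMap.comp_apply, h2, map_smul, LinearMap.smul_apply, smul_eq_mul, smul_eq_mul] at h1
      have h3 : γ * (1 - q ^ (i : ℕ)) * b.coord i (g (b 0)) = 0 := by linear_combination h1
      have hi' : (i : ℕ) ≠ 0 := fun h => hi (Fin.ext h)
      have h4 := (mul_eq_zero.mp h3).resolve_left (mul_ne_zero hγ (sub_ne_zero.mpr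
        (hq.pow_ne_one_of_pos_of_lt hi' i.2).symm))
      rw [Module.Basis.coord_apply] at h4
      rw [h4, map_smul, Module.Basis.repr_self, Finsupp.smul_apply,
        Finsupp.single_eq_of_ne hi, smul_zero]
  refine ⟨b.coord 0 (g (b 0)), fun w => ?_⟩
  have h1 : g = b.coord 0 (g (b 0)) • LinearMap.id := by
    refine b.ext fun i => ?_
    rw [LinearMap.smul_apply, LinearMap.id_apply]
    induction i using Fin.induction with
    | zero => exact h0
    | succ i ih =>
      rw [← hG, ← LinearMap.comp_apply g, hgG, LinearMap.comp_apply, ih, map_smul]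
  exact LinearMap.congr_fun h1 w

theorem dualTensorHomEquiv_comm_sum_coord {ι : Type*} [Fintype ι] [FiniteDimensional K V]
    (b : Module.Basis ι K V) : dualTensorHomEquiv K V V
      (TensorProduct.comm K V (Module.Dual K V) (∑ i, b i ⊗ₜ[K] b.coord i)) = LinearMap.id := by
  refine LinearMap.ext fun w => ?_
  rw [map_sum, map_sum, LinearMap.sum_apply]
  refine Eq.trans (Finset.sum_congr rfl fun i _ => ?_) (b.sum_repr w)
  simp [dualTensorHom_apply]

/-- The library coevaluation uses a chosen basis. The canonical tensor of any basis corresponds to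
the identity under `V ⊗ V* ≅ End V`, so an adapted basis may replace the chosen one. -/
theorem coevaluation_apply_one_basis {ι : Type*} [Fintype ι] [FiniteDimensional K V]
    (b : Module.Basis ι K V) : coevaluation K V 1 = ∑ i, b i ⊗ₜ[K] b.coord i := by
  apply (TensorProduct.comm K V (Module.Dual K V)).injective
  apply (dualTensorHomEquiv K V V).injective
  rw [coevaluation_apply_one, dualTensorHomEquiv_comm_sum_coord, dualTensorHomEquiv_comm_sum_coord]

end CyclicBasis

/-- Extends `IsWeightSystem.ext` to maps between different spaces, which is needed to compare the
two sides of an intertwining relation. -/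
theorem IsWeightSystem.hom_ext {V W : Type*} [AddCommGroup V] [Module ℂ V] [AddCommGroup W]
    [Module ℂ W] {P : ℤ → Module.End ℂ V} (hP : IsWeightSystem P) {X Y : V →ₗ[ℂ] W}
    (h : ∀ i, X ∘ₗ P i = Y ∘ₗ P i) : X = Y := by
  have e : ∀ Z : V →ₗ[ℂ] W, Z = ∑ᶠ i, Z ∘ₗ P i := by
    intro Z
    have h1 := AddMonoidHom.map_finsum
      (AddMonoidHom.mk' (fun A : Module.End ℂ V => Z ∘ₗ A) (fun A B => LinearMap.comp_add A B Z))
      hP.finite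
    rw [hP.sum] at h1
    exact h1
  rw [e X, e Y]
  exact finsum_congr h

/-! ### The action of `K⁻¹` on tensor products and its naturality. -/

namespace SplitModule

variable {m l : ℕ}

open TensorProduct

/-- `K⁻¹` is grouplike: on the part of bidegree `(i, j)` the scalar `ε^(-(i+j))` factors, and `x⁻¹`
is grouplike. -/
theorem tensorRep_Kinv {V W : Type*} [AddCommGroup V] [Module ℂ V] [AddCommGroup W] [Module ℂ W]
    (ρ : Rep m l (Module.End ℂ V)) (σ : Rep m l (Module.End ℂ W)) :
    (tensorRep ρ σ).Kinv = map ρ.Kinv σ.Kinv := by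
  apply tensor_ext ρ.weights σ.weights
  intro i j
  have e : map (ρ.P i) (σ.P j) = tensorP ρ.P σ.P (i + j) * map (ρ.P i) (σ.P j) := by
    rw [tensorP_mul_map ρ.weights σ.weights, if_pos rfl]
  have h := (tensorRep ρ σ).Kinv_mul_P (i + j)
  change _ * tensorP ρ.P σ.P (i + j) = (eps m l ^ (-(i + j)) •
    map ((ρ.x⁻¹ : (Module.End ℂ V)ˣ) : Module.End ℂ V)
      ((σ.x⁻¹ : (Module.End ℂ W)ˣ) : Module.End ℂ W) ^ 2) * tensorP ρ.P σ.P (i + j) at h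
  rw [e, ← mul_assoc, h, mul_assoc, ← e, ← TensorProduct.map_mul, ρ.Kinv_mul_P, σ.Kinv_mul_P]
  simp only [smul_mul_assoc, pow_two, map_smul_left, map_smul_right, TensorProduct.map_mul,
    smul_smul, ← zpow_add₀ (eps_ne_zero m l), neg_add]
  rw [add_comm (-i)]

theorem unitRep_Kinv : (unitRep m l).Kinv = 1 := by
  apply (unitRep m l).weights.ext
  intro i
  rw [Rep.Kinv_mul_P]
  change (_ • ((1 : (Module.End ℂ ℂ)ˣ)⁻¹ : (Module.End ℂ ℂ)ˣ).val ^ 2) *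
    (if i = 0 then 1 else 0) = 1 * (if i = 0 then 1 else 0)
  by_cases hi : i = 0 <;> simp [hi]

/-- `K⁻¹` is assembled from `x⁻¹` and the weight projections, and a map that intertwines `x` also
intertwines its inverse. -/
theorem IsHom.map_Kinv {M : SplitModule.{u} m l} {N : SplitModule.{v} m l} {f : M →ₗ[ℂ] N}
    (hf : IsHom M N f) : f ∘ₗ M.rep.Kinv = N.rep.Kinv ∘ₗ f := by
  have hx : ∀ w, f (((M.rep.x⁻¹ : (Module.End ℂ M)ˣ) : Module.End ℂ M) w) =
      ((N.rep.x⁻¹ : (Module.End ℂ N)ˣ) : Module.End ℂ N) (f w) := by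
    intro w
    have h1 := LinearMap.congr_fun hf.map_x
      (((M.rep.x⁻¹ : (Module.End ℂ M)ˣ) : Module.End ℂ M) w)
    rw [LinearMap.comp_apply, LinearMap.comp_apply, ← Module.End.mul_apply, Units.mul_inv,
      Module.End.one_apply] at h1
    rw [h1, ← Module.End.mul_apply, Units.inv_mul, Module.End.one_apply]
  have hP : ∀ i w, f (M.rep.P i w) = N.rep.P i (f w) := fun i => LinearMap.congr_fun (hf.map_P i)
  apply M.rep.weights.hom_ext
  intro i
  refine LinearMap.ext fun w => ?_
  have h1 := LinearMap.congr_fun (M.rep.Kinv_mul_P i) w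
  have h2 := LinearMap.congr_fun (N.rep.Kinv_mul_P i) (f w)
  rw [Module.End.mul_apply] at h1 h2
  rw [LinearMap.comp_apply, LinearMap.comp_apply, LinearMap.comp_apply, LinearMap.comp_apply, h1,
    hP, h2]
  simp only [Module.End.mul_apply, LinearMap.smul_apply, pow_two, map_smul, hx, hP]

/-! ### Linear maps compatible with the Borel part. -/

section BorelHom

variable {V W U : Type*} [AddCommGroup V] [Module ℂ V] [AddCommGroup W] [Module ℂ W]
  [AddCommGroup U] [Module ℂ U]

/-- Linear maps that commute with the action of the Borel subalgebra generated by `F` and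
`K⁻¹`. -/
structure IsBorelHom (ρ : Rep m l (Module.End ℂ V)) (σ : Rep m l (Module.End ℂ W))
    (f : V →ₗ[ℂ] W) : Prop where
  map_F : ∀ w, f (ρ.F w) = σ.F (f w)
  map_Kinv : ∀ w, f (ρ.Kinv w) = σ.Kinv (f w)

variable {ρ : Rep m l (Module.End ℂ V)} {σ : Rep m l (Module.End ℂ W)}
  {τ : Rep m l (Module.End ℂ U)}

theorem tensorRep_F_tmul (x : V) (y : W) : (tensorRep ρ σ).F (x ⊗ₜ[ℂ] y) =
    ρ.F x ⊗ₜ[ℂ] y + ρ.Kinv x ⊗ₜ[ℂ] σ.F y := rfl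

theorem tensorRep_Kinv_tmul (x : V) (y : W) : (tensorRep ρ σ).Kinv (x ⊗ₜ[ℂ] y) =
    ρ.Kinv x ⊗ₜ[ℂ] σ.Kinv y :=
  LinearMap.congr_fun (tensorRep_Kinv ρ σ) (x ⊗ₜ[ℂ] y)

theorem unitRep_F_apply (c : ℂ) : (unitRep m l).F c = 0 := rfl

theorem unitRep_Kinv_apply (c : ℂ) : (unitRep m l).Kinv c = c :=
  LinearMap.congr_fun (unitRep_Kinv (m := m) (l := l)) c

theorem IsHom.isBorelHom {M : SplitModule.{u} m l} {N : SplitModule.{v} m l} {f : M →ₗ[ℂ] N}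
    (hf : IsHom M N f) : IsBorelHom M.rep N.rep f :=
  ⟨LinearMap.congr_fun hf.map_F, LinearMap.congr_fun hf.map_Kinv⟩

namespace IsBorelHom

theorem comp {f : V →ₗ[ℂ] W} {g : W →ₗ[ℂ] U} (hg : IsBorelHom σ τ g) (hf : IsBorelHom ρ σ f) :
    IsBorelHom ρ τ (g ∘ₗ f) where
  map_F w := by rw [LinearMap.comp_apply, LinearMap.comp_apply, hf.map_F, hg.map_F]
  map_Kinv w := by rw [LinearMap.comp_apply, LinearMap.comp_apply, hf.map_Kinv, hg.map_Kinv]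

theorem symm {f : V ≃ₗ[ℂ] W} (hf : IsBorelHom ρ σ f.toLinearMap) :
    IsBorelHom σ ρ f.symm.toLinearMap where
  map_F w := by
    have h := hf.map_F (f.symm w)
    simp only [LinearEquiv.coe_coe, LinearEquiv.apply_symm_apply] at h ⊢
    rw [LinearEquiv.symm_apply_eq, h]
  map_Kinv w := by
    have h := hf.map_Kinv (f.symm w)
    simp only [LinearEquiv.coe_coe, LinearEquiv.apply_symm_apply] at h ⊢
    rw [LinearEquiv.symm_apply_eq, h]

theorem of_tmul {f : V ⊗[ℂ] W →ₗ[ℂ] U}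
    (hF : ∀ x y, f ((tensorRep ρ σ).F (x ⊗ₜ[ℂ] y)) = τ.F (f (x ⊗ₜ[ℂ] y)))
    (hK : ∀ x y, f ((tensorRep ρ σ).Kinv (x ⊗ₜ[ℂ] y)) = τ.Kinv (f (x ⊗ₜ[ℂ] y))) :
    IsBorelHom (tensorRep ρ σ) τ f where
  map_F w := by
    induction w with
    | zero => simp only [map_zero]
    | add a b ha hb => simp only [map_add, ha, hb]
    | tmul x y => exact hF x y
  map_Kinv w := by
    induction w with
    | zero => simp only [map_zero]
    | add a b ha hb => simp only [map_add, ha, hb]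
    | tmul x y => exact hK x y

theorem lTensor {f : V →ₗ[ℂ] W} (hf : IsBorelHom ρ σ f) (τ : Rep m l (Module.End ℂ U)) :
    IsBorelHom (tensorRep τ ρ) (tensorRep τ σ) (f.lTensor U) := by
  apply of_tmul
  · intro x y
    simp only [tensorRep_F_tmul, map_add, LinearMap.lTensor_tmul, hf.map_F]
  · intro x y
    simp only [tensorRep_Kinv_tmul, LinearMap.lTensor_tmul, hf.map_Kinv]

/-- The term `K⁻¹ ⊗ F` of `Δ(F)` is why compatibility with `K⁻¹` must accompany compatibility with
`F`. These two conditions together are stable under tensoring on either side. -/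
theorem rTensor {f : V →ₗ[ℂ] W} (hf : IsBorelHom ρ σ f) (τ : Rep m l (Module.End ℂ U)) :
    IsBorelHom (tensorRep ρ τ) (tensorRep σ τ) (f.rTensor U) := by
  apply of_tmul
  · intro x y
    simp only [tensorRep_F_tmul, map_add, LinearMap.rTensor_tmul, hf.map_F, hf.map_Kinv]
  · intro x y
    simp only [tensorRep_Kinv_tmul, LinearMap.rTensor_tmul, hf.map_Kinv]

theorem rid (ρ : Rep m l (Module.End ℂ V)) :
    IsBorelHom (tensorRep ρ (unitRep m l)) ρ (TensorProduct.rid ℂ V).toLinearMap := by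
  apply of_tmul
  · intro x y
    rw [tensorRep_F_tmul, unitRep_F_apply, tmul_zero, add_zero]
    simp
  · intro x y
    rw [tensorRep_Kinv_tmul, unitRep_Kinv_apply]
    simp

theorem lid (ρ : Rep m l (Module.End ℂ V)) :
    IsBorelHom (tensorRep (unitRep m l) ρ) ρ (TensorProduct.lid ℂ V).toLinearMap := by
  apply of_tmul
  · intro x y
    rw [tensorRep_F_tmul, unitRep_F_apply, unitRep_Kinv_apply, zero_tmul, zero_add]
    simp
  · intro x y
    rw [tensorRep_Kinv_tmul, unitRep_Kinv_apply]
    simp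

/-- Coassociativity on `F`: both bracketings give `F ⊗ 1 ⊗ 1 + K⁻¹ ⊗ F ⊗ 1 + K⁻¹ ⊗ K⁻¹ ⊗ F`, because
`K⁻¹` is grouplike. -/
theorem assoc (ρ : Rep m l (Module.End ℂ V)) (σ : Rep m l (Module.End ℂ W))
    (τ : Rep m l (Module.End ℂ U)) :
    IsBorelHom (tensorRep (tensorRep ρ σ) τ) (tensorRep ρ (tensorRep σ τ))
      (TensorProduct.assoc ℂ V W U).toLinearMap := by
  apply of_tmul
  · intro x z
    induction x with
    | zero => simp only [zero_tmul, map_zero]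
    | add a b ha hb => simp only [add_tmul, map_add, ha, hb]
    | tmul x y =>
      simp only [tensorRep_F_tmul, tensorRep_Kinv_tmul, add_tmul, tmul_add, map_add,
        LinearEquiv.coe_coe, TensorProduct.assoc_tmul, add_assoc]
  · intro x z
    induction x with
    | zero => simp only [zero_tmul, map_zero]
    | add a b ha hb => simp only [add_tmul, map_add, ha, hb]
    | tmul x y =>
      simp only [tensorRep_Kinv_tmul, LinearEquiv.coe_coe, TensorProduct.assoc_tmul]

end IsBorelHom

end BorelHom

/-! ### Partial traces: equivariance and coordinate formulas. -/

section PartialTrace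

variable {M : SplitModule.{u} m l}

/-- Every factor in the defining composition is a Borel map; the term lists them from last to first.
-/
theorem isBorelHom_rightPartialTrace {f : M.tensor M →ₗ[ℂ] M.tensor M}
    (hf : IsHom (M.tensor M) (M.tensor M) f) :
    IsBorelHom M.rep M.rep (M.rightPartialTrace f) :=
  (IsBorelHom.rid M.rep).comp <| (M.dual.isHom_ev.isBorelHom.lTensor M.rep).comp <|
    ((M.isHom_mu.isBorelHom.rTensor M.dual.rep).lTensor M.rep).comp <|
    (IsBorelHom.assoc M.rep M.rep M.dual.rep).comp <|
    (hf.isBorelHom.rTensor M.dual.rep).comp <|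
    (IsBorelHom.assoc M.rep M.rep M.dual.rep).symm.comp <|
    (M.isHom_coev.isBorelHom.lTensor M.rep).comp (IsBorelHom.rid M.rep).symm

theorem isBorelHom_leftPartialTrace {f : M.tensor M →ₗ[ℂ] M.tensor M}
    (hf : IsHom (M.tensor M) (M.tensor M) f) :
    IsBorelHom M.rep M.rep (M.leftPartialTrace f) :=
  (IsBorelHom.lid M.rep).comp <| (M.isHom_ev.isBorelHom.rTensor M.rep).comp <|
    (IsBorelHom.assoc M.dual.rep M.rep M.rep).symm.comp <|
    (hf.isBorelHom.lTensor M.dual.rep).comp <|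
    (IsBorelHom.assoc M.dual.rep M.rep M.rep).comp <|
    ((M.isHom_mu.isBorelHom.symm.lTensor M.dual.rep).rTensor M.rep).comp <|
    (M.dual.isHom_coev.isBorelHom.rTensor M.rep).comp (IsBorelHom.lid M.rep).symm

/-- The isomorphism `μ` acts after `f` on the second factor, so its `K^(1-l)` is absorbed into the
coordinate functional. -/
theorem apply_rightPartialTrace {ι : Type*} [Fintype ι] (b : Module.Basis ι ℂ M)
    (f : M.tensor M →ₗ[ℂ] M.tensor M) (ψ : Module.Dual ℂ M) (w : M) :
    ψ (M.rightPartialTrace f w) = ∑ i, dualDistrib ℂ M M (ψ ⊗ₜ (b.coord i ∘ₗ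
      ((M.rep.K ^ (1 - (l : ℤ)) : (Module.End ℂ M)ˣ) : Module.End ℂ M))) (f (w ⊗ₜ b i)) := by
  have h1 : ∀ (y : M ⊗[ℂ] M) (θ : Module.Dual ℂ M), ψ (TensorProduct.rid ℂ M
      (M.dual.ev.lTensor M ((M.mu.toLinearMap.rTensor M.dual).lTensor M
        (TensorProduct.assoc ℂ M M M.dual (y ⊗ₜ θ))))) = dualDistrib ℂ M M (ψ ⊗ₜ (θ ∘ₗ
      ((M.rep.K ^ (1 - (l : ℤ)) : (Module.End ℂ M)ˣ) : Module.End ℂ M))) y := by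
    intro y θ
    induction y with
    | zero => simp only [zero_tmul, map_zero]
    | add a b ha hb => simp only [add_tmul, map_add, ha, hb]
    | tmul x y =>
      rw [TensorProduct.assoc_tmul, LinearMap.lTensor_tmul, LinearMap.lTensor_tmul,
        LinearMap.rTensor_tmul, TensorProduct.rid_tmul, map_smul, smul_eq_mul, dualDistrib_apply,
        mul_comm]
      rfl
  have h2 : M.coev 1 = ∑ i, b i ⊗ₜ[ℂ] b.coord i := coevaluation_apply_one_basis b
  have h3 : M.rightPartialTrace f w = TensorProduct.rid ℂ M
      (M.dual.ev.lTensor M ((M.mu.toLinearMap.rTensor M.dual).lTensor M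
        (TensorProduct.assoc ℂ M M M.dual (f.rTensor M.dual
          ((TensorProduct.assoc ℂ M M M.dual).symm (w ⊗ₜ M.coev 1)))))) := rfl
  rw [h3, h2, tmul_sum]
  simp only [map_sum, TensorProduct.assoc_symm_tmul, LinearMap.rTensor_tmul]
  exact Finset.sum_congr rfl fun i _ => h1 _ _

/-- Here `μ⁻¹` acts before `f`, so `K^(l-1)` is applied to the basis vector in the first factor. -/
theorem apply_leftPartialTrace {ι : Type*} [Fintype ι] (b : Module.Basis ι ℂ M)
    (f : M.tensor M →ₗ[ℂ] M.tensor M) (ψ : Module.Dual ℂ M) (w : M) :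
    ψ (M.leftPartialTrace f w) = ∑ i, dualDistrib ℂ M M (b.coord i ⊗ₜ ψ)
      (f (((M.rep.K ^ ((l : ℤ) - 1) : (Module.End ℂ M)ˣ) : Module.End ℂ M) (b i) ⊗ₜ w)) := by
  classical
  have h1 : ∀ (y : M ⊗[ℂ] M) (θ : Module.Dual ℂ M), ψ (TensorProduct.lid ℂ M
      (M.ev.rTensor M ((TensorProduct.assoc ℂ M.dual M M).symm (θ ⊗ₜ y)))) =
      dualDistrib ℂ M M (θ ⊗ₜ ψ) y := by
    intro y θ
    induction y with
    | zero => simp only [tmul_zero, map_zero]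
    | add a b ha hb => simp only [tmul_add, map_add, ha, hb]
    | tmul x y =>
      rw [TensorProduct.assoc_symm_tmul, LinearMap.rTensor_tmul, TensorProduct.lid_tmul, map_smul,
        smul_eq_mul, dualDistrib_apply]
      rfl
  -- Taking the dual basis for the dual module makes the second legs evaluations at the `b i`; the
  -- canonical map hidden in `μ⁻¹` then undoes them.
  have h2 : M.dual.coev 1 = ∑ i, b.coord i ⊗ₜ[ℂ] Module.Dual.eval ℂ M (b i) := by
    have h := coevaluation_apply_one_basis b.dualBasis
    have e : ∀ i, b.dualBasis.coord i = Module.Dual.eval ℂ M (b i) := by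
      intro i
      refine b.dualBasis.ext fun j => ?_
      simp [Finsupp.single_apply]
    simp only [e, Module.Basis.coe_dualBasis] at h
    exact h
  have h3 : M.leftPartialTrace f w = TensorProduct.lid ℂ M
      (M.ev.rTensor M ((TensorProduct.assoc ℂ M.dual M M).symm (f.lTensor M.dual
        (TensorProduct.assoc ℂ M.dual M M ((M.mu.symm.toLinearMap.lTensor M.dual)
          (M.dual.coev 1) ⊗ₜ w))))) := rfl
  have h4 : ∀ y, M.mu.symm (Module.Dual.eval ℂ M y) =
      ((M.rep.K ^ ((l : ℤ) - 1) : (Module.End ℂ M)ˣ) : Module.End ℂ M) y := by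
    intro y
    rw [LinearEquiv.symm_apply_eq]
    have h : ((M.rep.K ^ (1 - (l : ℤ)) : (Module.End ℂ M)ˣ) : Module.End ℂ M)
        (((M.rep.K ^ ((l : ℤ) - 1) : (Module.End ℂ M)ˣ) : Module.End ℂ M) y) = y := by
      rw [← Module.End.mul_apply, ← Units.val_mul, ← zpow_add, sub_add_sub_cancel', sub_self,
        zpow_zero, Units.val_one, Module.End.one_apply]
    exact congrArg (Module.Dual.eval ℂ M) h.symm
  rw [h3, h2]
  simp only [map_sum, sum_tmul, LinearMap.lTensor_tmul, TensorProduct.assoc_tmul,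
    LinearEquiv.coe_coe, h4]
  exact Finset.sum_congr rfl fun i _ => h1 _ _

end PartialTrace

variable {m l : ℕ}

theorem isPrimitiveRoot_eps_sq (hl : 0 < l) (hml : Nat.Coprime m l) :
    IsPrimitiveRoot (eps m l ^ 2) l :=
  IsPrimitiveRoot.mk_of_lt _ hl (eps_pow m l) fun _ hi hil => eps_sq_pow_ne_one hml hi hil

/-! ### Modules spanned by `F`-powers of a highest weight vector. -/

section HighestWeight

variable {V : Type*} [AddCommGroup V] [Module ℂ V]

/-- `v` is annihilated by `E`, has weight `k`, and `x` acts on it by `a`. -/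
structure IsHighestWeight (ρ : Rep m l (Module.End ℂ V)) (a : ℂˣ) (k : ℤ) (v : V) : Prop where
  E_apply : ρ.E v = 0
  x_apply : (ρ.x : Module.End ℂ V) v = (a : ℂ) • v
  P_apply : ∀ j, ρ.P j v = if j = k then v else 0

theorem Kinv_apply_of_Kval_apply {ρ : Rep m l (Module.End ℂ V)} {w : V} {c : ℂ} (hc : c ≠ 0)
    (h : ρ.Kval w = c • w) : ρ.Kinv w = c⁻¹ • w := by
  have h1 := LinearMap.congr_fun ρ.Kinv_mul_Kval w
  rw [Module.End.mul_apply, h, map_smul, Module.End.one_apply] at h1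
  rw [← h1, smul_smul, inv_mul_cancel₀ hc, one_smul, h1]

namespace IsHighestWeight

variable {ρ : Rep m l (Module.End ℂ V)} {a : ℂˣ} {k : ℤ} {v : V}

theorem x_F_pow (h : IsHighestWeight ρ a k v) (i : ℕ) :
    (ρ.x : Module.End ℂ V) ((ρ.F ^ i) v) = (a : ℂ) • (ρ.F ^ i) v := by
  rw [← Module.End.mul_apply,
    (Commute.pow_right (show Commute (ρ.x : Module.End ℂ V) ρ.F from ρ.x_comm_F) i).eq,
    Module.End.mul_apply, h.x_apply, map_smul]

theorem P_F_pow (h : IsHighestWeight ρ a k v) (i : ℕ) : ∀ j,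
    ρ.P j ((ρ.F ^ i) v) = if j = k - 2 * (i : ℤ) then (ρ.F ^ i) v else 0 := by
  induction i with
  | zero => simpa using h.P_apply
  | succ i ih =>
    intro j
    rw [pow_succ', Module.End.mul_apply, ← Module.End.mul_apply, ρ.P_mul_F, Module.End.mul_apply,
      ih]
    by_cases hj : j = k - 2 * ((i + 1 : ℕ) : ℤ)
    · rw [if_pos hj, if_pos (by push_cast at hj; omega)]
    · rw [if_neg hj, if_neg (by push_cast at hj; omega), map_zero]

theorem Kval_F_pow (h : IsHighestWeight ρ a k v) (i : ℕ) :
    ρ.Kval ((ρ.F ^ i) v) = ((a : ℂ) ^ 2 * eps m l ^ (k - 2 * (i : ℤ))) • (ρ.F ^ i) v := by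
  have h1 := LinearMap.congr_fun (ρ.Kval_mul_P (k - 2 * (i : ℤ))) ((ρ.F ^ i) v)
  rw [Module.End.mul_apply, Module.End.mul_apply, h.P_F_pow, if_pos rfl] at h1
  rw [h1, LinearMap.smul_apply, pow_two, Module.End.mul_apply, h.x_F_pow, map_smul, h.x_F_pow,
    smul_smul, smul_smul]
  congr 1
  ring

theorem weight_ne_zero (m l : ℕ) (a : ℂˣ) (j : ℤ) : (a : ℂ) ^ 2 * eps m l ^ j ≠ 0 :=
  mul_ne_zero (pow_ne_zero _ a.ne_zero) (zpow_ne_zero _ (eps_ne_zero m l))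

theorem Kinv_F_pow (h : IsHighestWeight ρ a k v) (i : ℕ) :
    ρ.Kinv ((ρ.F ^ i) v) = (((a : ℂ) ^ 2 * eps m l ^ k)⁻¹ * (eps m l ^ 2) ^ i) • (ρ.F ^ i) v := by
  rw [Kinv_apply_of_Kval_apply (weight_ne_zero m l a _) (h.Kval_F_pow i)]
  congr 1
  rw [zpow_sub₀ (eps_ne_zero m l), zpow_mul, zpow_natCast, mul_inv, mul_inv, inv_div, mul_assoc,
    div_eq_inv_mul]
  norm_cast

/-- Commute one `F` past `E` at a time: each step adds the value of `EF - FE` on a weight vector,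
and `coeffE_succ_sub` sums these. -/
theorem E_F_pow_succ (h : IsHighestWeight ρ a k v) (i : ℕ) :
    ρ.E ((ρ.F ^ (i + 1)) v) = coeffE m l a k (i + 1) • (ρ.F ^ i) v := by
  -- Phrased through `F E Fⁱ v`, the induction needs no vector of index `i - 1`; at `i = 0` both
  -- sides vanish.
  have step : ∀ i : ℕ, ρ.F (ρ.E ((ρ.F ^ i) v)) = coeffE m l a k i • (ρ.F ^ i) v →
      ρ.E ((ρ.F ^ (i + 1)) v) = coeffE m l a k (i + 1) • (ρ.F ^ i) v := by
    intro i hi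
    have h1 := LinearMap.congr_fun ρ.E_mul_F_sub_eq_K ((ρ.F ^ i) v)
    rw [LinearMap.sub_apply, Module.End.mul_apply, Module.End.mul_apply, hi, LinearMap.smul_apply,
      LinearMap.sub_apply, h.Kval_F_pow, Kinv_apply_of_Kval_apply (weight_ne_zero m l a _)
      (h.Kval_F_pow i), ← sub_smul, smul_smul, sub_eq_iff_eq_add] at h1
    rw [pow_succ', Module.End.mul_apply, h1, ← add_smul]
    congr 1
    rw [← eq_sub_iff_add_eq, coeffE_succ_sub, zpow_neg, mul_inv, inv_pow]
    ring
  induction i with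
  | zero =>
    apply step
    rw [pow_zero, Module.End.one_apply, h.E_apply, map_zero, coeffE_zero, zero_smul]
  | succ i ih =>
    apply step
    rw [ih, map_smul, pow_succ', Module.End.mul_apply]

/-- `E` maps `F^(i+1)v` to a nonzero multiple of `Fⁱv`, by the genericity of `a`, so no power below
`l` can kill `v`. -/
theorem F_pow_ne_zero (h : IsHighestWeight ρ a k v) (hv : v ≠ 0) (hl : 1 < l)
    (hml : Nat.Coprime m l) (ha : (a : ℂ) ^ (4 * l) ≠ 1) {i : ℕ} (hi : i < l) :
    (ρ.F ^ i) v ≠ 0 := by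
  induction i with
  | zero => exact hv
  | succ i ih =>
    intro h0
    have h1 := h.E_F_pow_succ i
    rw [h0, map_zero] at h1
    exact smul_ne_zero (coeffE_ne_zero a k hl hml ha (Nat.succ_pos i) hi) (ih (by omega)) h1.symm

/-- The vectors `Fⁱv` are eigenvectors of `K⁻¹` whose eigenvalues differ by distinct powers of a
primitive root, hence are independent. -/
theorem exists_basis (h : IsHighestWeight ρ a k v) (hv : v ≠ 0) (hl : 1 < l)
    (hml : Nat.Coprime m l) (ha : (a : ℂ) ^ (4 * l) ≠ 1)
    (hspan : Submodule.span ℂ (Set.range fun i : Fin l => (ρ.F ^ (i : ℕ)) v) = ⊤) :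
    ∃ b : Module.Basis (Fin l) ℂ V, ∀ i, b i = (ρ.F ^ (i : ℕ)) v := by
  have hli : LinearIndependent ℂ fun i : Fin l => (ρ.F ^ (i : ℕ)) v := by
    refine Module.End.eigenvectors_linearIndependent' ρ.Kinv
      (fun i : Fin l => ((a : ℂ) ^ 2 * eps m l ^ k)⁻¹ * (eps m l ^ 2) ^ (i : ℕ)) ?_ _ fun i =>
      Module.End.hasEigenvector_iff.mpr ⟨Module.End.mem_eigenspace_iff.mpr (h.Kinv_F_pow i),
        h.F_pow_ne_zero hv hl hml ha i.2⟩
    intro i j hij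
    exact Fin.ext ((isPrimitiveRoot_eps_sq (by omega) hml).pow_inj i.2 j.2
      (mul_left_cancel₀ (inv_ne_zero (weight_ne_zero m l a k)) hij))
  exact ⟨Module.Basis.mk hli hspan.ge, fun i => Module.Basis.mk_apply _ _ i⟩

/-- `Fˡv` has weight `k - 2l`, but the spanning vectors only have weights `k - 2i` with `i < l`.
Integer weights are essential, since `K` alone does not separate `Fˡv` from `v`. -/
theorem F_pow_eq_zero (h : IsHighestWeight ρ a k v)
    (hspan : Submodule.span ℂ (Set.range fun i : Fin l => (ρ.F ^ (i : ℕ)) v) = ⊤) :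
    (ρ.F ^ l) v = 0 := by
  have h1 : ρ.P (k - 2 * (l : ℤ)) = 0 := by
    refine LinearMap.ext_on_range hspan fun i => ?_
    rw [h.P_F_pow, if_neg (by omega), LinearMap.zero_apply]
  have h2 := h.P_F_pow l (k - 2 * (l : ℤ))
  rw [if_pos rfl, h1, LinearMap.zero_apply] at h2
  exact h2.symm

end IsHighestWeight

end HighestWeight

theorem pow_apply_of_apply_eq_smul {V : Type*} [AddCommGroup V] [Module ℂ V]
    {A : Module.End ℂ V} {w : V} {c : ℂ} (h : A w = c • w) (n : ℕ) : (A ^ n) w = c ^ n • w := by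
  induction n with
  | zero => simp
  | succ n ih => rw [pow_succ', Module.End.mul_apply, ih, map_smul, h, smul_smul, pow_succ]

/-! ### Each trace as one corner matrix coefficient. -/

section Ambidextrous

variable {n : ℕ} {M : SplitModule.{u} m (n + 1)} {γ q : ℂ}

/-- With `l = n + 1` the ribbon factor `K^(1-l)` is `(K⁻¹)ⁿ`, so the coordinate formula is the
weighted sum of `sum_coord_eq_of_commute` for `G = F`, `H = K⁻¹`. -/
theorem coord_rightPartialTrace (hγ : γ ≠ 0) (hq : IsPrimitiveRoot q (n + 1))
    {b : Module.Basis (Fin (n + 1)) ℂ M} (hF : ∀ i : Fin n, M.rep.F (b i.castSucc) = b i.succ)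
    (hFl : M.rep.F (b (Fin.last n)) = 0) (hK : ∀ i, M.rep.Kinv (b i) = (γ * q ^ (i : ℕ)) • b i)
    {f : M.tensor M →ₗ[ℂ] M.tensor M} (hf : IsHom (M.tensor M) (M.tensor M) f) :
    b.coord 0 (M.rightPartialTrace f (b 0)) =
      dualDistrib ℂ M M (b.coord 0 ⊗ₜ b.coord (Fin.last n)) (f (b (Fin.last n) ⊗ₜ b 0)) := by
  have hz : ((M.rep.K ^ (1 - ((n + 1 : ℕ) : ℤ)) : (Module.End ℂ M)ˣ) : Module.End ℂ M) =
      M.rep.Kinv ^ n := by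
    rw [show (1 - ((n + 1 : ℕ) : ℤ)) = -(n : ℤ) by push_cast; ring, zpow_neg, zpow_natCast,
      ← inv_pow, Units.val_pow_eq_pow_val]
    rfl
  rw [apply_rightPartialTrace b, hz, ← sum_coord_eq_of_commute hγ hq hF hFl hK (f := f) hf.map_F]
  refine Finset.sum_congr rfl fun i _ => ?_
  rw [coord_comp_eq_smul (μ := fun i : Fin (n + 1) => (γ * q ^ (i : ℕ)) ^ n)
    (fun i => pow_apply_of_apply_eq_smul (hK i) n), tmul_smul, map_smul, LinearMap.smul_apply,
    smul_eq_mul]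

/-- The mirror image, with `G = E`, `H = K` and `K^(l-1) = Kⁿ`. -/
theorem coord_leftPartialTrace (hγ : γ ≠ 0) (hq : IsPrimitiveRoot q (n + 1))
    {b : Module.Basis (Fin (n + 1)) ℂ M} (hE : ∀ i : Fin n, M.rep.E (b i.castSucc) = b i.succ)
    (hEl : M.rep.E (b (Fin.last n)) = 0) (hK : ∀ i, M.rep.Kval (b i) = (γ * q ^ (i : ℕ)) • b i)
    {f : M.tensor M →ₗ[ℂ] M.tensor M} (hf : IsHom (M.tensor M) (M.tensor M) f) :
    b.coord 0 (M.leftPartialTrace f (b 0)) =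
      dualDistrib ℂ M M (b.coord (Fin.last n) ⊗ₜ b.coord 0) (f (b 0 ⊗ₜ b (Fin.last n))) := by
  have hz : ((M.rep.K ^ (((n + 1 : ℕ) : ℤ) - 1) : (Module.End ℂ M)ˣ) : Module.End ℂ M) =
      M.rep.Kval ^ n := by
    rw [show (((n + 1 : ℕ) : ℤ) - 1) = (n : ℤ) by push_cast; ring, zpow_natCast,
      Units.val_pow_eq_pow_val]
    rfl
  -- The flip turns `Δ(E) = E ⊗ K + 1 ⊗ E` into the skew form `E ⊗ 1 + K ⊗ E`, so the conjugate of
  -- `f` by `τ` satisfies the commutation hypothesis.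
  let τ : M ⊗[ℂ] M →ₗ[ℂ] M ⊗[ℂ] M := (TensorProduct.comm ℂ M M).toLinearMap
  have hτ : ∀ x y : M, τ (x ⊗ₜ y) = y ⊗ₜ x := fun x y => TensorProduct.comm_tmul ℂ M M x y
  let f' : Module.End ℂ (M ⊗[ℂ] M) := τ ∘ₗ f ∘ₗ τ
  have hτE : ∀ y, τ ((M.tensor M).rep.E y) = skewOp M.rep.E M.rep.Kval (τ y) := by
    have h : τ ∘ₗ (map M.rep.E M.rep.Kval + map 1 M.rep.E) =
        (map M.rep.E 1 + map M.rep.Kval M.rep.E) ∘ₗ τ := by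
      refine TensorProduct.ext' fun x y => ?_
      simp only [LinearMap.comp_apply, LinearMap.add_apply, map_tmul, map_add, hτ,
        Module.End.one_apply]
      exact add_comm _ _
    exact LinearMap.congr_fun h
  have hττ : ∀ y, τ (τ y) = y := (TensorProduct.comm ℂ M M).symm_apply_apply
  have hf' : f' * skewOp M.rep.E M.rep.Kval = skewOp M.rep.E M.rep.Kval * f' := by
    refine LinearMap.ext fun y => ?_
    have h := LinearMap.congr_fun hf.map_E (τ y)
    rw [LinearMap.comp_apply, LinearMap.comp_apply] at h
    change τ (f (τ (skewOp M.rep.E M.rep.Kval y))) = skewOp M.rep.E M.rep.Kval (τ (f (τ y)))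
    rw [← hτE, ← h]
    congr 2
    rw [← hττ ((M.tensor M).rep.E (τ y)), hτE, hττ]
  have hD : ∀ (φ ψ : Module.Dual ℂ M) (y : M ⊗[ℂ] M),
      dualDistrib ℂ M M (φ ⊗ₜ ψ) y = dualDistrib ℂ M M (ψ ⊗ₜ φ) (τ y) := by
    intro φ ψ y
    induction y with
    | zero => simp only [map_zero]
    | add x y hx hy => simp only [map_add, hx, hy]
    | tmul x y => rw [hτ, dualDistrib_apply, dualDistrib_apply, mul_comm]
  have key := sum_coord_eq_of_commute hγ hq hE hEl hK hf'
  have e : ∀ x y : M, f' (x ⊗ₜ y) = τ (f (y ⊗ₜ x)) := fun x y => rfl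
  simp only [e, ← hD] at key
  rw [apply_leftPartialTrace b, hz, ← key]
  refine Finset.sum_congr rfl fun i _ => ?_
  rw [pow_apply_of_apply_eq_smul (hK i) n, ← smul_tmul', map_smul, map_smul, smul_eq_mul]

end Ambidextrous

/-- Provides the basis `Eⁱbₙ` generated from the lowest vector. It is the reversed basis `b` up to
nonzero scalars, and only the two end vectors and their coordinates are needed for the comparison.
-/
theorem IsHighestWeight.exists_lowering_basis {m n : ℕ} {V : Type*} [AddCommGroup V] [Module ℂ V]
    {ρ : Rep m (n + 1) (Module.End ℂ V)} {a : ℂˣ} {k : ℤ} {v : V} (h : IsHighestWeight ρ a k v)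
    (hl : 1 < n + 1) (hml : Nat.Coprime m (n + 1)) (ha : (a : ℂ) ^ (4 * (n + 1)) ≠ 1)
    {b : Module.Basis (Fin (n + 1)) ℂ V} (hb : ∀ i, b i = (ρ.F ^ (i : ℕ)) v) :
    ∃ (b' : Module.Basis (Fin (n + 1)) ℂ V) (c : ℂ), c ≠ 0 ∧
      b' 0 = b (Fin.last n) ∧ b'.coord 0 = b.coord (Fin.last n) ∧
      b' (Fin.last n) = c • b 0 ∧ b'.coord (Fin.last n) = c⁻¹ • b.coord 0 ∧
      (∀ i : Fin n, ρ.E (b' i.castSucc) = b' i.succ) ∧ ρ.E (b' (Fin.last n)) = 0 ∧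
      ∀ i, ρ.Kval (b' i) =
        ((a : ℂ) ^ 2 * eps m (n + 1) ^ (k - 2 * (n : ℤ)) * (eps m (n + 1) ^ 2) ^ (i : ℕ)) •
          b' i := by
  -- The scalar with `Eⁱbₙ = c i • bₙ₋ᵢ`: each application of `E` contributes the coefficient of the
  -- current index, starting from `n`.
  let c : ℕ → ℂ := fun i => ∏ r ∈ Finset.range i, coeffE m (n + 1) a k (n - r)
  have hc : ∀ i, i ≤ n → c i ≠ 0 := fun i hi => Finset.prod_ne_zero_iff.mpr fun r hr => by
    have := Finset.mem_range.mp hr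
    exact coeffE_ne_zero a k hl hml ha (by omega) (by omega)
  let w : Fin (n + 1) → ℂˣ := fun i => Units.mk0 (c i) (hc i (by omega))
  let b' := (b.reindex Fin.revPerm).unitsSMul w
  have hb' : ∀ i, b' i = c i • b i.rev := fun i => by
    simp only [b', Module.Basis.unitsSMul_apply, Module.Basis.reindex_apply, Fin.revPerm_symm,
      Fin.revPerm_apply]
    rfl
  have hcoord : ∀ i, b'.coord i = (c i)⁻¹ • b.coord i.rev := fun i => by
    refine LinearMap.ext fun y => ?_
    simp only [b', Module.Basis.coord_unitsSMul, LinearMap.smul_apply, Module.Basis.coord_apply,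
      Module.Basis.repr_reindex_apply, Fin.revPerm_symm, Fin.revPerm_apply]
    rfl
  have hc0 : c 0 = 1 := Finset.prod_range_zero _
  refine ⟨b', c n, hc n le_rfl, ?_, ?_, ?_, ?_, ?_, ?_, ?_⟩
  · rw [hb', Fin.rev_zero, Fin.val_zero, hc0, one_smul]
  · rw [hcoord, Fin.rev_zero, Fin.val_zero, hc0, inv_one, one_smul]
  · rw [hb', Fin.rev_last, Fin.val_last]
  · rw [hcoord, Fin.rev_last, Fin.val_last]
  · intro i
    have hi : n - (i : ℕ) = n - (i + 1) + 1 := by omega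
    rw [hb', hb', map_smul, hb, hb, Fin.val_rev, Fin.val_rev, Fin.val_castSucc, Fin.val_succ,
      Nat.add_sub_add_right, Nat.add_sub_add_right, hi, h.E_F_pow_succ, smul_smul, ← hi]
    congr 1
    exact (Finset.prod_range_succ _ _).symm
  · rw [hb', Fin.rev_last, map_smul, hb, Fin.val_zero, pow_zero, Module.End.one_apply, h.E_apply,
      smul_zero]
  · intro i
    rw [hb', map_smul, hb, h.Kval_F_pow, smul_comm]
    congr 1
    rw [mul_assoc, ← pow_mul, ← zpow_natCast (eps m (n + 1)), ← zpow_add₀ (eps_ne_zero _ _),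
      Fin.val_rev]
    congr 2
    push_cast
    omega

end SplitModule
end SplitSl2

open SplitSl2 SplitModule TensorProduct in
theorem mainTheorem1 (m l : ℕ) (hm : Odd m) (hl : Odd l) (hl1 : 1 < l) (hml : Nat.Coprime m l)
    (a : ℂˣ) (ha : (a : ℂ) ^ (4 * l) ≠ 1) (k : ℤ)
    (V : SplitSl2.SplitModule.{u} m l) (hV : V.IsV a k) :
    V.IsAmbidextrous := by
  obtain ⟨n, rfl⟩ : ∃ n, l = n + 1 := ⟨l - 1, by omega⟩
  obtain ⟨v, hv, hE, hx, hP, hspan⟩ := hV.highestWeight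
  have h : IsHighestWeight V.rep a k v := ⟨hE, hx, hP⟩
  have hq := isPrimitiveRoot_eps_sq (Nat.succ_pos n) hml
  obtain ⟨b, hb⟩ := h.exists_basis hv hl1 hml ha hspan
  obtain ⟨b', c, hc, h0, h0', hn, hn', hE', hEl, hK'⟩ := h.exists_lowering_basis hl1 hml ha hb
  have hγ := inv_ne_zero (IsHighestWeight.weight_ne_zero m (n + 1) a k)
  have hF : ∀ i : Fin n, V.rep.F (b i.castSucc) = b i.succ := fun i => by
    rw [hb, hb, Fin.val_succ, pow_succ', Module.End.mul_apply, Fin.val_castSucc]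
  have hFl : V.rep.F (b (Fin.last n)) = 0 := by
    rw [hb, ← Module.End.mul_apply, ← pow_succ', Fin.val_last, h.F_pow_eq_zero hspan]
  have hK : ∀ i, V.rep.Kinv (b i) =
      (((a : ℂ) ^ 2 * eps m (n + 1) ^ k)⁻¹ * (eps m (n + 1) ^ 2) ^ (i : ℕ)) • b i := fun i => by
    rw [hb, h.Kinv_F_pow]
  intro f hf
  -- Schur's lemma for the Borel part: one scalar governs the whole map, so the two traces may be
  -- evaluated at opposite ends of the basis.
  have hscalar : ∀ g : V →ₗ[ℂ] V, IsBorelHom V.rep V.rep g → ∃ c : ℂ, ∀ w, g w = c • w :=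
    fun g hg => exists_eq_smul_of_commute hγ hq hF hK (LinearMap.ext hg.map_F)
      (LinearMap.ext hg.map_Kinv)
  obtain ⟨r, hr⟩ := hscalar _ (isBorelHom_rightPartialTrace hf)
  obtain ⟨s, hs⟩ := hscalar _ (isBorelHom_leftPartialTrace hf)
  have hR := coord_rightPartialTrace hγ hq hF hFl hK hf
  have hL := coord_leftPartialTrace (IsHighestWeight.weight_ne_zero m (n + 1) a _) hq hE' hEl hK' hf
  have hself : ∀ b : Module.Basis (Fin (n + 1)) ℂ V, b.coord 0 (b 0) = 1 := fun b => by simp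
  rw [hr, map_smul, hself, smul_eq_mul, mul_one] at hR
  -- Rewritten in the basis `b`, the left corner coefficient carries `c` from the vector and `c⁻¹`
  -- from the coordinate. They cancel and leave the right corner coefficient.
  rw [hs, map_smul, hself, smul_eq_mul, mul_one, h0, h0', hn, hn', tmul_smul, map_smul, map_smul,
    ← smul_tmul', map_smul, LinearMap.smul_apply, smul_smul, mul_inv_cancel₀ hc, one_smul] at hL
  refine LinearMap.ext fun w => ?_
  rw [hr, hs, hR, hL]
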